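/- Uncapacitated facility location: a finite nonempty set $F$ of facility locations with opening costs $f_i\ge 0$ and a (pseudo)metric $d$ on $F$ is given upfront. Clients arrive one by one; an arriving client specifies its distances $d(j,i)$ to all $i\in F$, which together with $d$ satisfy the triangle inequality. A solution for the clients $C$ that have arrived is a set $S\subseteq F$ of open facilities and a map $\sigma:C\to S$; its cost is $\sum_{i\in S}f_i+\sum_{j\in C}d(j,\sigma_j)$. A deterministic online algorithm maintains at every time $t$ (after $t$ arrivals) a solution that is a function of the clients that have arrived so far. An adaptive adversary chooses each next client after having seen all solutions the algorithm has held so far. The facility recourse up to time $T$ is $\sum_{t<T}|S_t\,\triangle\,S_{t+1}|$, and the client recourse is the number of pairs $(t,j)$ with $t<T$, $j$ among the first $t$ clients, whose facility at time $t+1$ differs from that at time $t$. **Theorem.** There are absolute constants $c,K>0$ such that for every $0<\epsilon\le\frac12$ and every $(F,f,d)$ there is a deterministic online algorithm such that, against every adaptive adversary and for every number $T$ of arrived clients, with $n=|F|+T$: 1. the cost of the algorithm's solution at time $T$ is at most $(1+\sqrt2+\epsilon)$ times the optimum cost for the $T$ clients that have arrived; 2. the total facility recourse and the total client recourse up to time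 $T$ are each at most $K\cdot\frac{\log n}{\epsilon}\log\frac1\epsilon\cdot T$, i.e. both amortized recourses are $O\!\left(\frac{\log n}{\epsilon}\log\frac1\epsilon\right)$. Moreover, the algorithm is the following local search with $\epsilon'=c\,\epsilon$, split into stages with freezing. For a current client set $C$ and a solution $(S,\sigma)$ for $C$, a local operation (a) opens some $i\in F$ (possibly already open) and reconnects some clients of $C$ to it, or (b) closes some $i'\in S$ and reconnects its clients to facilities in $S\setminus\{i'\}$, or (c) opens $i\notin S$, closes $i'\in S$, reconnects the clients of $i'$ to facilities in $S\setminus\{i'\}\cup\{i\}$, and possibly other clients to $i$. It is $\phi$-efficient if it decreases $\sqrt2\sum_{i\in S}f_i+\sum_{j\in C}d(j,\sigma_j)$ by more than $\phi$ times the number of clients it reconnects. The algorithm starts with $C=S=\emptyset$. When a client $j$ arrives, it is added to $C$; if $\min_{i\in F\setminus S}(f_i+d(i,j))<\min_{i\in S}d(j,i)$ (the minimum over the empty set being $\infty$), a minimizer $i\in F\setminus S$ is opened and $j$ is connected to it, otherwise $j$ is connected to a nearest facility of $S$. Then, as long as there is an $\frac{\epsilon'\cdot \mathrm{cost}(S,\sigma)}{(1+\sqrt2)|C|}$-efficient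 local operation, one is performed. Finally, if $\mathrm{cost}(S,\sigma)>\frac1{\epsilon'}\mathrm{cost}(S^\circ,\sigma^\circ)$, where $C^\circ$ and $(S^\circ,\sigma^\circ)$ are the client set and solution at the beginning of the current stage, the stage ends: the facilities in $S^\circ$ are permanently opened, the clients in $C^\circ$ are permanently connected according to $\sigma^\circ$ and removed from $C$ (the facilities of $S$ remain in $S$), and a new stage begins. The solution maintained has as open facilities those in $S$ and the permanently opened ones. -/

import Mathlib

noncomputable section

/-- The part of an instance of uncapacitated facility location that is known upfront: opening costs
and a (pseudo)metric on the set `F` of facility locations. -/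
structure FLInstance (F : Type*) where
  openCost : F → ℝ
  openCost_nonneg : ∀ i, 0 ≤ openCost i
  dist : F → F → ℝ
  dist_self : ∀ i, dist i i = 0
  dist_comm : ∀ i i', dist i i' = dist i' i
  dist_triangle : ∀ i i' i'', dist i i'' ≤ dist i i' + dist i' i''

/-- A client is specified by its distances to all facility locations. The triangle inequalities are
exactly those that make `F` together with the client a (pseudo)metric space; any sequence of
clients then embeds with `F` into one common (pseudo)metric space. Distances between clients play
no role in the problem and are not given. -/
structure Client {F : Type*} (I : FLInstance F) where
  dist : F → ℝ
  dist_nonneg : ∀ i, 0 ≤ dist i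
  dist_le : ∀ i i', dist i ≤ dist i' + I.dist i' i
  le_dist_add_dist : ∀ i i', I.dist i i' ≤ dist i + dist i'

/-- A set of facilities together with a map from clients to facilities. -/
@[ext]
structure Config (F ι : Type*) where
  S : Finset F
  σ : ι → F

namespace FLInstance

variable {F : Type*} {ι : Type*} (I : FLInstance F)

/-- The opening cost of a set of facilities. -/
def facCost (S : Finset F) : ℝ := ∑ i ∈ S, I.openCost i

/-- The connection cost of the clients in `C`. -/
def connCost (x : ι → Client I) (C : Finset ι) (σ : ι → F) : ℝ := ∑ j ∈ C, (x j).dist (σ j)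

/-- The cost of a solution for the clients in `C`. -/
def cost (x : ι → Client I) (C : Finset ι) (p : Config F ι) : ℝ :=
  I.facCost p.S + I.connCost x C p.σ

/-- The cost with facility costs scaled by `√2`. -/
def scaledCost (x : ι → Client I) (C : Finset ι) (p : Config F ι) : ℝ :=
  √2 * I.facCost p.S + I.connCost x C p.σ

end FLInstance

/-- A solution for `t` clients: every client is connected to an open facility. -/
structure Solution (F : Type*) (t : ℕ) extends Config F (Fin t) where
  σ_mem : ∀ j, σ j ∈ S

/-- The cost of an optimum solution for the clients `x`. (For nonempty finite `F` this is an infimum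
over a finite nonempty type, hence a minimum.) -/
def FLInstance.opt {F : Type*} (I : FLInstance F) {t : ℕ} (x : Fin t → Client I) : ℝ :=
  ⨅ s : Solution F t, I.cost x Finset.univ s.toConfig

/-! ### Online algorithms, adaptive adversaries, recourse -/

/-- A deterministic online algorithm: the solution held at time `t` is a function of the `t` clients
that have arrived so far. -/
def OnlineAlgorithm {F : Type*} (I : FLInstance F) : Type _ :=
  (t : ℕ) → (Fin t → Client I) → Solution F t

/-- An adaptive adversary: it chooses the next client after having seen the solutions that the
algorithm held at the times `0, …, t`. -/
def Adversary {F : Type*} (I : FLInstance F) : Type _ :=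
  (t : ℕ) → ((s : Fin (t + 1)) → Solution F s) → Client I

namespace OnlineAlgorithm

variable {F : Type*} {I : FLInstance F}

/-- The sequence of clients that arise when the algorithm plays against the adversary. -/
def arrivals (A : OnlineAlgorithm I) (adv : Adversary I) : ℕ → Client I
  | t => adv t (fun s => A s (fun j => arrivals A adv j))
  termination_by t => t
  decreasing_by
    have h1 := s.isLt
    have h2 := j.isLt
    omega

/-- The first `t` clients. -/
def history (A : OnlineAlgorithm I) (adv : Adversary I) (t : ℕ) : Fin t → Client I :=
  fun j => A.arrivals adv j

/-- The solution held at time `t` against the adversary. -/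
def solution (A : OnlineAlgorithm I) (adv : Adversary I) (t : ℕ) : Solution F t :=
  A t (A.history adv t)

/-- Number of facilities opened or closed during the first `T` times. -/
def facilityRecourse [DecidableEq F] (A : OnlineAlgorithm I) (adv : Adversary I) (T : ℕ) : ℕ :=
  ∑ t ∈ Finset.range T, (symmDiff (A.solution adv t).S (A.solution adv (t + 1)).S).card

/-- Number of reconnections during the first `T` times: at each time, the previously arrived clients
whose facility has changed are counted. -/
def clientRecourse [DecidableEq F] (A : OnlineAlgorithm I) (adv : Adversary I) (T : ℕ) : ℕ :=
  ∑ t ∈ Finset.range T,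
    (Finset.univ.filter fun j : Fin t =>
      (A.solution adv (t + 1)).σ j.castSucc ≠ (A.solution adv t).σ j).card

end OnlineAlgorithm

/-! ### Local search in stages with freezing -/

namespace LocalSearch

variable {F : Type*} [DecidableEq F] {ι : Type*} [DecidableEq ι]

/-- `LocalOp C p q R`: a valid local operation leads from `p` to `q`, reconnecting the clients in
`R ⊆ C`, where `C` is the set of current clients. -/
inductive LocalOp (C : Finset ι) : Config F ι → Config F ι → Finset ι → Prop
  /-- open `i` (possibly already open) and reconnect the clients in `R` to it -/
  | openOp (p : Config F ι) (i : F) (R : Finset ι) (hR : R ⊆ C) :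
      LocalOp C p ⟨insert i p.S, fun j => if j ∈ R then i else p.σ j⟩ R
  /-- close `i'` and reconnect its clients to other open facilities -/
  | closeOp (p : Config F ι) (i' : F) (hi' : i' ∈ p.S) (σ' : ι → F) (R : Finset ι)
      (hR : R = C.filter fun j => p.σ j = i')
      (h_mem : ∀ j ∈ R, σ' j ∈ p.S.erase i')
      (h_eq : ∀ j, j ∉ R → σ' j = p.σ j) :
      LocalOp C p ⟨p.S.erase i', σ'⟩ R
  /-- open `i`, close `i'`, reconnect the clients of `i'`, and possibly some other clients to `i` -/
  | swapOp (p : Config F ι) (i i' : F) (hi : i ∉ p.S) (hi' : i' ∈ p.S) (σ' : ι → F) (R : Finset ι)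
      (hR : R ⊆ C) (hR' : ∀ j ∈ C, p.σ j = i' → j ∈ R)
      (h_mem : ∀ j ∈ R, p.σ j = i' → σ' j ∈ insert i (p.S.erase i'))
      (h_other : ∀ j ∈ R, p.σ j ≠ i' → σ' j = i)
      (h_eq : ∀ j, j ∉ R → σ' j = p.σ j) :
      LocalOp C p ⟨insert i (p.S.erase i'), σ'⟩ R

variable (I : FLInstance F)

/-- Some `φ`-efficient local operation leads from `p` to `q`: it decreases the scaled cost by more
than `φ` times the number of clients it reconnects. -/
def Efficient (x : ι → Client I) (C : Finset ι) (φ : ℝ) (p q : Config F ι) : Prop :=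
  ∃ R : Finset ι, LocalOp C p q R ∧
    φ * (R.card : ℝ) < I.scaledCost x C p - I.scaledCost x C q

/-- The efficiency threshold `ε' · cost(S, σ) / ((1 + √2) |C|)`. -/
def threshold (ε' : ℝ) (x : ι → Client I) (C : Finset ι) (p : Config F ι) : ℝ :=
  ε' * I.cost x C p / ((1 + √2) * (C.card : ℝ))

/-- One iteration of the local search loop. -/
def Improve (ε' : ℝ) (x : ι → Client I) (C : Finset ι) (p q : Config F ι) : Prop :=
  Efficient I x C (threshold I ε' x C p) p q

/-- The local search loop, started at `p`, ends at `q`. -/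
def Settles (ε' : ℝ) (x : ι → Client I) (C : Finset ι) (p q : Config F ι) : Prop :=
  Relation.ReflTransGen (Improve I ε' x C) p q ∧ ∀ q', ¬ Improve I ε' x C q q'

variable {I}

/-- `InitialConnect y S S' i`: when client `y` arrives and `S` is the set of open facilities, the
algorithm connects `y` to `i` and `S'` is the new set of open facilities. A closed facility is
opened iff its opening plus connection cost is less than the distance to `S` (which is infinite for
`S = ∅`). -/
inductive InitialConnect (y : Client I) (S : Finset F) : Finset F → F → Prop
  | openNew (i : F) (hi : i ∉ S)
      (h_min : ∀ i', i' ∉ S → I.openCost i + y.dist i ≤ I.openCost i' + y.dist i')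
      (h_lt : ∀ i' ∈ S, I.openCost i + y.dist i < y.dist i') :
      InitialConnect y S (insert i S) i
  | useOpen (i : F) (hi : i ∈ S)
      (h_min : ∀ i' ∈ S, y.dist i ≤ y.dist i')
      (h_le : ∀ i', i' ∉ S → y.dist i ≤ I.openCost i' + y.dist i') :
      InitialConnect y S S i

/-- The internal state after `t` arrivals. -/
structure State (F : Type*) (t : ℕ) where
  /-- current (not yet frozen) clients -/
  C : Finset (Fin t)
  /-- open facilities of the current solution, and connections of all clients, frozen or not -/
  cur : Config F (Fin t)
  /-- client set at the beginning of the stage -/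
  C₀ : Finset (Fin t)
  /-- solution at the beginning of the stage -/
  start : Config F (Fin t)
  /-- permanently opened facilities -/
  frozen : Finset F

/-- Before the first arrival there are no clients and no open facilities. -/
def State.IsInitial (s : State F 0) : Prop :=
  s.cur.S = ∅ ∧ s.start.S = ∅ ∧ s.frozen = ∅

/-- What happens at the end of a time, when local search has stopped at `q` (with current clients
`C`, and `C₀`, `p₀` the client set and solution at the beginning of the stage). If the cost exceeds
`cost(p₀) / ε'`, the stage ends: the facilities of `p₀` are permanently opened, the clients `C₀`
are permanently connected according to `p₀` and removed from `C`, and a new stage begins. -/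
def finish (ε' : ℝ) {t : ℕ} (x : Fin t → Client I) (C C₀ : Finset (Fin t))
    (p₀ q : Config F (Fin t)) (frozen : Finset F) : State F t :=
  open Classical in
  if I.cost x C₀ p₀ / ε' < I.cost x C q then
    let q' : Config F (Fin t) := ⟨q.S, fun j => if j ∈ C₀ then p₀.σ j else q.σ j⟩
    { C := C \ C₀, cur := q', C₀ := C \ C₀, start := q', frozen := frozen ∪ p₀.S }
  else
    { C := C, cur := q, C₀ := C₀, start := p₀, frozen := frozen }

/-- One time of the algorithm: the last client of `x` arrives, is connected, local search is run
until it stops, and the stage is possibly ended. (`Fin.castSucc` regards the `t` old clients as the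
first `t` of the `t + 1` clients; the value of the snapshot at the new client is irrelevant.) -/
def Step (ε' : ℝ) {t : ℕ} (x : Fin (t + 1) → Client I) (s : State F t) (s' : State F (t + 1)) :
    Prop :=
  ∃ (S' : Finset F) (i : F) (q : Config F (Fin (t + 1))),
    InitialConnect (x (Fin.last t)) s.cur.S S' i ∧
    Settles I ε' x (insert (Fin.last t) (s.C.map Fin.castSuccEmb))
      ⟨S', Fin.snoc (α := fun _ => F) s.cur.σ i⟩ q ∧
    s' = finish ε' x (insert (Fin.last t) (s.C.map Fin.castSuccEmb)) (s.C₀.map Fin.castSuccEmb)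
      ⟨s.start.S, Fin.snoc (α := fun _ => F) s.start.σ i⟩ q s.frozen

end LocalSearch

/-- The online algorithm is local search with parameter `ε'`, split into stages with freezing: it
maintains an internal state, determined by the clients that have arrived, that evolves as
prescribed; its open facilities are the permanently opened ones and those of the current solution.
(Ties and the choice among several efficient operations are left to the algorithm.) -/
def OnlineAlgorithm.IsStagedLocalSearch {F : Type*} [DecidableEq F] {I : FLInstance F}
    (A : OnlineAlgorithm I) (ε' : ℝ) : Prop :=
  ∃ st : (t : ℕ) → (Fin t → Client I) → LocalSearch.State F t,
    (∀ x, (st 0 x).IsInitial) ∧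
    (∀ (t : ℕ) (x : Fin (t + 1) → Client I),
      LocalSearch.Step ε' x (st t fun j => x j.castSucc) (st (t + 1) x)) ∧
    ∀ (t : ℕ) (x : Fin t → Client I),
      (A t x).S = (st t x).frozen ∪ (st t x).cur.S ∧ (A t x).σ = (st t x).cur.σ

end

/-! Approximation. A local optimum `p` is tested against an arbitrary solution `r`. Opening the
facilities of `r` bounds the connection cost of `p` by √2·fac(r) + conn(r). Closing or swapping out
each facility of `p`, with clients rerouted via the facility of `p` nearest to their facility in
`r`, gives √2·fac(p) ≤ √2·fac(r) + 2·conn(r). The first bound plus 1/√2 times the second is the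
factor 1 + √2 (`cost_le_of_not_efficient`); the efficiency threshold costs a further factor 1 +
O(ε'). A stage ends only when the cost has grown by a factor 1/ε', so the frozen costs decay
geometrically backwards in time and add only O(ε') times the optimum (`Snapshot.Valid.freeze`).

Client recourse. Let a(t) be the optimum for the current clients C and b(t) the decrease of the
scaled cost by local search at time t. A reconnection gains on the order of ε'a/|C|, so there are
O(|C|·b/(ε'a)) of them. Within a stage, the decreases are paid for by the cost at its beginning and
by the increases at arrivals. A client arriving in the star of a facility k of a reference solution
can be connected via any earlier client of that star; averaging over the m earlier ones, whose
connection cost is controlled by the operation that opens k, bounds the increase by about a 1/m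
fraction of the star's cost. Harmonic sums make the total O(log n)·a (`sum_increase_le`). Apart from
the arrival that ends the stage, a grows by a factor O(1/ε') only, so b/a sums to O(log n ·
log(1/ε')) over a stage (`sum_div_le_of_sum_le`, `Trace.U_le`). Each client is current during at
most two stages, which amortizes the weights |C| (`Trace.sum_N_le_aux`).

Facility recourse. An operation that reconnects nobody can still open a facility, but only by
swapping out a facility of positive cost without clients. Counting idle and newly opened facilities
together therefore bounds the openings by the initially idle facilities plus twice the reconnections
(`LocalOp.card_idleOrNew_le`). Local search leaves no idle facility; freezing creates at most one
per frozen client. Closings and permanent openings are bounded by openings.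

The algorithm is deterministic, so its play against an adaptive adversary is its run on one
particular sequence of clients, and bounds valid for every sequence suffice. -/

set_option linter.unusedSectionVars false

/-! ### Feasibility and elementary cost estimates -/

namespace Config

variable {F ι : Type*}

/-- Every client in `C` is connected to an open facility. -/
def Feasible (C : Finset ι) (p : Config F ι) : Prop := ∀ j ∈ C, p.σ j ∈ p.S

end Config

namespace FLInstance

variable {F ι : Type*} (I : FLInstance F)

theorem dist_nonneg (i i' : F) : 0 ≤ I.dist i i' := by
  have h := I.dist_triangle i i' i
  rw [I.dist_self, I.dist_comm i' i] at h
  linarith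

theorem facCost_nonneg (S : Finset F) : 0 ≤ I.facCost S :=
  Finset.sum_nonneg fun i _ => I.openCost_nonneg i

theorem connCost_nonneg (x : ι → Client I) (C : Finset ι) (σ : ι → F) : 0 ≤ I.connCost x C σ :=
  Finset.sum_nonneg fun j _ => (x j).dist_nonneg _

theorem cost_nonneg (x : ι → Client I) (C : Finset ι) (p : Config F ι) : 0 ≤ I.cost x C p :=
  add_nonneg (I.facCost_nonneg _) (I.connCost_nonneg x C _)

theorem scaledCost_nonneg (x : ι → Client I) (C : Finset ι) (p : Config F ι) :
    0 ≤ I.scaledCost x C p :=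
  add_nonneg (mul_nonneg (Real.sqrt_nonneg 2) (I.facCost_nonneg _)) (I.connCost_nonneg x C _)

theorem one_le_sqrt_two : (1 : ℝ) ≤ √2 := by
  rw [Real.one_le_sqrt]; norm_num

theorem scaledCost_le (x : ι → Client I) (C : Finset ι) (p : Config F ι) :
    I.scaledCost x C p ≤ √2 * I.cost x C p := by
  have h := I.connCost_nonneg x C p.σ
  have h2 := one_le_sqrt_two
  unfold scaledCost cost
  nlinarith

theorem facCost_insert_le [DecidableEq F] (i : F) (S : Finset F) :
    I.facCost (insert i S) ≤ I.openCost i + I.facCost S := by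
  by_cases h : i ∈ S
  · rw [Finset.insert_eq_of_mem h]
    linarith [I.openCost_nonneg i]
  · exact (Finset.sum_insert h).le

theorem facCost_erase [DecidableEq F] {i : F} {S : Finset F} (h : i ∈ S) :
    I.facCost (S.erase i) = I.facCost S - I.openCost i := by
  have := Finset.add_sum_erase S I.openCost h
  unfold facCost
  linarith

theorem facCost_mono {S S' : Finset F} (h : S ⊆ S') : I.facCost S ≤ I.facCost S' :=
  Finset.sum_le_sum_of_subset_of_nonneg h fun i _ _ => I.openCost_nonneg i

theorem facCost_union_le [DecidableEq F] (S S' : Finset F) :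
    I.facCost (S ∪ S') ≤ I.facCost S + I.facCost S' := by
  have h := Finset.sum_union_inter (s₁ := S) (s₂ := S') (f := I.openCost)
  have h2 := I.facCost_nonneg (S ∩ S')
  unfold facCost at *
  linarith

theorem connCost_mono (x : ι → Client I) {C C' : Finset ι} (h : C ⊆ C') (σ : ι → F) :
    I.connCost x C σ ≤ I.connCost x C' σ :=
  Finset.sum_le_sum_of_subset_of_nonneg h fun _ _ _ => (x _).dist_nonneg _

theorem cost_mono (x : ι → Client I) {C C' : Finset ι} (h : C ⊆ C') (p : Config F ι) :
    I.cost x C p ≤ I.cost x C' p :=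
  add_le_add le_rfl (I.connCost_mono x h _)

theorem connCost_congr (x : ι → Client I) {C : Finset ι} {σ σ' : ι → F}
    (h : ∀ j ∈ C, σ j = σ' j) : I.connCost x C σ = I.connCost x C σ' :=
  Finset.sum_congr rfl fun j hj => by rw [h j hj]

/-- If `σ` and `σ'` differ only on `R`, so do their connection costs. -/
theorem connCost_sub (x : ι → Client I) {C R : Finset ι} (hR : R ⊆ C) {σ σ' : ι → F}
    (h : ∀ j, j ∉ R → σ' j = σ j) :
    I.connCost x C σ - I.connCost x C σ' =
      ∑ j ∈ R, ((x j).dist (σ j) - (x j).dist (σ' j)) := by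
  unfold connCost
  rw [← Finset.sum_sub_distrib]
  symm
  apply Finset.sum_subset hR
  intro j _ hj
  rw [h j hj, sub_self]

end FLInstance

/-! ### Approximation guarantee of local optima -/

namespace LocalSearch

open FLInstance

variable {F ι : Type*} [DecidableEq F] [DecidableEq ι] {I : FLInstance F} {x : ι → Client I}
  {C : Finset ι} {φ : ℝ} {p : Config F ι}

/-- The freedom to choose `R` matters twice: in the facility bound it is the part of a star served
by one facility, and in the recourse analysis it is the part of a star that has already arrived. -/
theorem open_inequality (h : ∀ q, ¬ Efficient I x C φ p q) (i : F) {R : Finset ι} (hR : R ⊆ C) :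
    ∑ j ∈ R, (x j).dist (p.σ j) ≤
      √2 * I.openCost i + ∑ j ∈ R, (x j).dist i + φ * R.card := by
  by_contra! hlt
  refine h _ ⟨R, LocalOp.openOp p i R hR, ?_⟩
  have h1 := I.connCost_sub x hR (σ := p.σ) (σ' := fun j => if j ∈ R then i else p.σ j)
    fun j hj => if_neg hj
  have h2 : ∑ j ∈ R, ((x j).dist (p.σ j) - (x j).dist (if j ∈ R then i else p.σ j)) =
      ∑ j ∈ R, ((x j).dist (p.σ j) - (x j).dist i) :=
    Finset.sum_congr rfl fun j hj => by rw [if_pos hj]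
  rw [h2, Finset.sum_sub_distrib] at h1
  have h3 := mul_le_mul_of_nonneg_left (I.facCost_insert_le i p.S) (Real.sqrt_nonneg 2)
  unfold scaledCost
  dsimp only
  linarith

theorem close_inequality (h : ∀ q, ¬ Efficient I x C φ p q) {i' : F} (hi' : i' ∈ p.S)
    (τ : ι → F) (hτ : ∀ j ∈ C, p.σ j = i' → τ j ∈ p.S.erase i') :
    √2 * I.openCost i' ≤
      ∑ j ∈ C with p.σ j = i', ((x j).dist (τ j) - (x j).dist (p.σ j) + φ) := by
  by_contra! hlt
  set R := C.filter fun j => p.σ j = i' with hRdef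
  have hR : R ⊆ C := Finset.filter_subset _ _
  refine h _ ⟨R, LocalOp.closeOp p i' hi' (fun j => if j ∈ R then τ j else p.σ j) R hRdef
    (fun j hj => ?_) (fun j hj => if_neg hj), ?_⟩
  · rw [if_pos hj]
    exact hτ j (Finset.mem_filter.1 hj).1 (Finset.mem_filter.1 hj).2
  have h1 := I.connCost_sub x hR (σ := p.σ) (σ' := fun j => if j ∈ R then τ j else p.σ j)
    fun j hj => if_neg hj
  have h2 : ∑ j ∈ R, ((x j).dist (p.σ j) - (x j).dist (if j ∈ R then τ j else p.σ j)) =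
      ∑ j ∈ R, ((x j).dist (p.σ j) - (x j).dist (τ j)) :=
    Finset.sum_congr rfl fun j hj => by rw [if_pos hj]
  rw [h2, Finset.sum_sub_distrib] at h1
  rw [Finset.sum_add_distrib, Finset.sum_sub_distrib, Finset.sum_const, nsmul_eq_mul] at hlt
  unfold scaledCost
  dsimp only
  rw [I.facCost_erase hi']
  nlinarith

/-- Only the clients of the closed facility are moved; the further reconnections that a swap permits
are not needed for the approximation factor. -/
theorem swap_inequality (h : ∀ q, ¬ Efficient I x C φ p q) {i i' : F} (hi : i ∉ p.S)
    (hi' : i' ∈ p.S) (τ : ι → F) (hτ : ∀ j ∈ C, p.σ j = i' → τ j ∈ insert i (p.S.erase i')) :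
    √2 * I.openCost i' ≤ √2 * I.openCost i +
      ∑ j ∈ C with p.σ j = i', ((x j).dist (τ j) - (x j).dist (p.σ j) + φ) := by
  by_contra! hlt
  set R := C.filter fun j => p.σ j = i' with hRdef
  have hR : R ⊆ C := Finset.filter_subset _ _
  refine h _ ⟨R, LocalOp.swapOp p i i' hi hi' (fun j => if j ∈ R then τ j else p.σ j) R hR
    (fun j hj hj' => Finset.mem_filter.2 ⟨hj, hj'⟩) (fun j hj hj' => ?_)
    (fun j hj hj' => absurd (Finset.mem_filter.1 hj).2 hj') (fun j hj => if_neg hj), ?_⟩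
  · rw [if_pos hj]
    exact hτ j (Finset.mem_filter.1 hj).1 (Finset.mem_filter.1 hj).2
  have h1 := I.connCost_sub x hR (σ := p.σ) (σ' := fun j => if j ∈ R then τ j else p.σ j)
    fun j hj => if_neg hj
  have h2 : ∑ j ∈ R, ((x j).dist (p.σ j) - (x j).dist (if j ∈ R then τ j else p.σ j)) =
      ∑ j ∈ R, ((x j).dist (p.σ j) - (x j).dist (τ j)) :=
    Finset.sum_congr rfl fun j hj => by rw [if_pos hj]
  rw [h2, Finset.sum_sub_distrib] at h1
  rw [Finset.sum_add_distrib, Finset.sum_sub_distrib, Finset.sum_const, nsmul_eq_mul] at hlt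
  have h3 := mul_le_mul_of_nonneg_left (I.facCost_insert_le i (p.S.erase i')) (Real.sqrt_nonneg 2)
  rw [I.facCost_erase hi'] at h3
  unfold scaledCost
  dsimp only
  linarith

/-- Each facility of `r` is opened for exactly its own star, and the stars partition `C`. -/
theorem connCost_le_of_not_efficient (h : ∀ q, ¬ Efficient I x C φ p q) {r : Config F ι}
    (hr : r.Feasible C) :
    I.connCost x C p.σ ≤ √2 * I.facCost r.S + I.connCost x C r.σ + φ * C.card := by
  have hsum : ∀ g : ι → ℝ, ∑ j ∈ C, g j = ∑ i ∈ r.S, ∑ j ∈ C with r.σ j = i, g j := fun g =>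
    (Finset.sum_fiberwise_of_maps_to hr g).symm
  have hc : (φ * C.card : ℝ) = ∑ j ∈ C, φ := by simp [mul_comm]
  unfold connCost facCost
  rw [hc, hsum, hsum fun j => (x j).dist (r.σ j), hsum fun _ => φ, Finset.mul_sum,
    ← Finset.sum_add_distrib, ← Finset.sum_add_distrib]
  refine Finset.sum_le_sum fun i _ => ?_
  refine (open_inequality h i (Finset.filter_subset (fun j => r.σ j = i) C)).trans (le_of_eq ?_)
  rw [Finset.sum_const, nsmul_eq_mul, mul_comm φ]
  congr 2
  exact Finset.sum_congr rfl fun j hj => by rw [(Finset.mem_filter.1 hj).2]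

/-- The inequality for a single open facility `i` of a local optimum: `η` maps every facility of
the comparison solution to its nearest facility of the local optimum. -/
theorem openCost_le_of_not_efficient (hφ : 0 ≤ φ) (h : ∀ q, ¬ Efficient I x C φ p q)
    {r : Config F ι} (hr : r.Feasible C) (η : F → F) (hη : ∀ k ∈ r.S, η k ∈ p.S)
    (hηmin : ∀ k ∈ r.S, ∀ i ∈ p.S, I.dist k (η k) ≤ I.dist k i)
    (hηself : ∀ k ∈ r.S, k ∈ p.S → η k = k) {i : F} (hi : i ∈ p.S) :
    √2 * I.openCost i ≤ √2 * ∑ k ∈ r.S with η k = i, I.openCost k +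
      ∑ j ∈ C with p.σ j = i, (2 * (x j).dist (r.σ j) + 2 * φ) := by
  have hs2 := one_le_sqrt_two
  -- The detour from `j` via `r.σ j` ends at a facility at most as far from `r.σ j` as `i` is.
  have near : ∀ j ∈ C, p.σ j = i →
      (x j).dist (η (r.σ j)) - (x j).dist (p.σ j) ≤ 2 * (x j).dist (r.σ j) := by
    intro j hj hji
    have h1 := (x j).dist_le (η (r.σ j)) (r.σ j)
    have h2 := hηmin _ (hr j hj) i hi
    have h3 := (x j).le_dist_add_dist (r.σ j) i
    rw [hji]
    linarith
  by_cases hP : ∃ k ∈ r.S, η k = i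
  · set P := r.S.filter fun k => η k = i with hPdef
    have hPne : P.Nonempty := hP.imp fun k hk => Finset.mem_filter.2 hk
    obtain ⟨m, hmP, hmmin⟩ : ∃ m ∈ P, ∀ k ∈ P, I.dist i m ≤ I.dist i k ∧ (i ∈ P → m = i) := by
      by_cases hiP : i ∈ P
      · exact ⟨i, hiP, fun k _ => ⟨(I.dist_self i).le.trans (I.dist_nonneg _ _), fun _ => rfl⟩⟩
      · obtain ⟨m, hm, hm2⟩ := Finset.exists_min_image P (I.dist i) hPne
        exact ⟨m, hm, fun k hk => ⟨hm2 k hk, fun h => absurd h hiP⟩⟩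
    have hmP' := Finset.mem_filter.1 hmP
    -- bound for the exchange of `i` against `m`
    have hswap : √2 * I.openCost i ≤ √2 * I.openCost m + ∑ j ∈ C with p.σ j = i,
        ((if η (r.σ j) = i ∧ r.σ j ≠ m then (x j).dist (r.σ j) + (x j).dist (p.σ j)
          else 2 * (x j).dist (r.σ j)) + φ) := by
      -- If `m = i` there is nothing to exchange. Otherwise `m` is closed in `p`, because `η` fixes
      -- the common facilities, so the swap is legal.
      by_cases hmi : m = i
      · subst hmi
        refine le_add_of_nonneg_right (Finset.sum_nonneg fun j _ => ?_)
        have h1 := (x j).dist_nonneg (r.σ j)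
        have h2 := (x j).dist_nonneg (p.σ j)
        split_ifs <;> linarith
      · have hmS : m ∉ p.S := fun hm => hmi ((hηself m hmP'.1 hm).symm.trans hmP'.2)
        refine (swap_inequality h hmS hi (fun j => if η (r.σ j) = i then m else η (r.σ j))
          (fun j hj hji => ?_)).trans ?_
        · split_ifs with hc
          · exact Finset.mem_insert_self _ _
          · exact Finset.mem_insert_of_mem (Finset.mem_erase.2 ⟨hc, hη _ (hr j hj)⟩)
        · gcongr with j hj
          obtain ⟨hjC, hji⟩ := Finset.mem_filter.1 hj
          by_cases hc : η (r.σ j) = i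
          · by_cases hm : r.σ j = m
            · have h1 := (x j).dist_nonneg (r.σ j)
              have h2 := (x j).dist_nonneg (p.σ j)
              rw [if_pos hc, if_neg (fun hh => hh.2 hm), hm]
              rw [hm] at h1
              linarith
            · simp only [hc, hm, if_true, ne_eq, not_false_eq_true, and_self]
              have h1 := (x j).dist_le m i
              have h2 := (hmmin (r.σ j) (Finset.mem_filter.2 ⟨hr j hjC, hc⟩)).1
              have h3 := (x j).le_dist_add_dist i (r.σ j)
              rw [hji]
              linarith
          · simp only [hc, if_false, false_and]
            exact near j hjC hji
    -- The other facilities of `P` enter through the opening operation, restricted to the clients of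
    -- `i` in their stars. Its negative distances to `p.σ j` cancel the positive ones left over from
    -- the swap, where such clients are moved to `m`.
    have hopen : ∀ k ∈ P.erase m, 0 ≤ √2 * I.openCost k +
        ∑ j ∈ (C.filter fun j => p.σ j = i) with r.σ j = k,
          ((x j).dist (r.σ j) - (x j).dist (p.σ j) + φ) := by
      intro k _
      have h1 := open_inequality h k (R := (C.filter fun j => p.σ j = i).filter fun j => r.σ j = k)
        ((Finset.filter_subset _ _).trans (Finset.filter_subset _ _))
      have h2 : ∑ j ∈ (C.filter fun j => p.σ j = i) with r.σ j = k, (x j).dist (r.σ j) =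
          ∑ j ∈ (C.filter fun j => p.σ j = i) with r.σ j = k, (x j).dist k :=
        Finset.sum_congr rfl fun j hj => by rw [(Finset.mem_filter.1 hj).2]
      rw [Finset.sum_add_distrib, Finset.sum_sub_distrib, Finset.sum_const, nsmul_eq_mul, h2]
      linarith
    have hopen' := Finset.sum_nonneg hopen
    rw [Finset.sum_add_distrib, ← Finset.mul_sum] at hopen'
    have hfib : ∑ k ∈ P.erase m, ∑ j ∈ (C.filter fun j => p.σ j = i) with r.σ j = k,
          ((x j).dist (r.σ j) - (x j).dist (p.σ j) + φ) =
        ∑ j ∈ C with p.σ j = i, if η (r.σ j) = i ∧ r.σ j ≠ m then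
          ((x j).dist (r.σ j) - (x j).dist (p.σ j) + φ) else 0 := by
      rw [← Finset.sum_filter]
      rw [← Finset.sum_fiberwise_of_maps_to (t := P.erase m) (g := r.σ)]
      · refine Finset.sum_congr rfl fun k hk => ?_
        congr 1
        ext j
        simp only [Finset.mem_filter, Finset.mem_erase, hPdef] at hk ⊢
        constructor
        · rintro ⟨a, rfl⟩
          exact ⟨⟨a, hk.2.2, hk.1⟩, rfl⟩
        · rintro ⟨⟨a, -⟩, b⟩
          exact ⟨a, b⟩
      · intro j hj
        simp only [Finset.mem_filter, Finset.mem_erase, hPdef] at hj ⊢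
        exact ⟨hj.2.2, hr j hj.1.1, hj.2.1⟩
    rw [hfib] at hopen'
    have hPsum := Finset.add_sum_erase P I.openCost hmP
    have htot : ∑ j ∈ C with p.σ j = i,
        ((if η (r.σ j) = i ∧ r.σ j ≠ m then (x j).dist (r.σ j) + (x j).dist (p.σ j)
          else 2 * (x j).dist (r.σ j)) + φ) +
        (∑ j ∈ C with p.σ j = i, if η (r.σ j) = i ∧ r.σ j ≠ m then
          ((x j).dist (r.σ j) - (x j).dist (p.σ j) + φ) else 0) ≤
        ∑ j ∈ C with p.σ j = i, (2 * (x j).dist (r.σ j) + 2 * φ) := by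
      rw [← Finset.sum_add_distrib]
      refine Finset.sum_le_sum fun j _ => ?_
      split_ifs <;> linarith
    rw [← hPsum, mul_add]
    linarith
  -- No facility of `r` is mapped to `i`, so all detours avoid `i` and it can simply be closed.
  · push Not at hP
    have h1 := close_inequality h hi (fun j => η (r.σ j))
      fun j hj hji => Finset.mem_erase.2 ⟨hP _ (hr j hj), hη _ (hr j hj)⟩
    have h2 : ∑ j ∈ C with p.σ j = i, ((x j).dist (η (r.σ j)) - (x j).dist (p.σ j) + φ) ≤
        ∑ j ∈ C with p.σ j = i, (2 * (x j).dist (r.σ j) + 2 * φ) := by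
      refine Finset.sum_le_sum fun j hj => ?_
      have := near j (Finset.mem_filter.1 hj).1 (Finset.mem_filter.1 hj).2
      linarith
    have h3 := mul_nonneg (Real.sqrt_nonneg 2) (I.facCost_nonneg (r.S.filter fun k => η k = i))
    unfold facCost at h3
    linarith

/-- Summing over the open facilities charges every facility of `r` once, through its fibre of `η`,
and every client once, through its fibre of `p.σ`. -/
theorem facCost_le_of_not_efficient (hφ : 0 ≤ φ) (h : ∀ q, ¬ Efficient I x C φ p q)
    (hp : p.Feasible C) {r : Config F ι} (hr : r.Feasible C) :
    √2 * I.facCost p.S ≤ √2 * I.facCost r.S + 2 * I.connCost x C r.σ + 2 * (φ * C.card) := by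
  rcases p.S.eq_empty_or_nonempty with hS | hS
  · have h1 := mul_nonneg (Real.sqrt_nonneg 2) (I.facCost_nonneg r.S)
    have h2 := I.connCost_nonneg x C r.σ
    rw [hS]
    simp only [facCost, Finset.sum_empty, mul_zero] at *
    positivity
  have hex : ∀ k, ∃ i ∈ p.S, (∀ i' ∈ p.S, I.dist k i ≤ I.dist k i') ∧ (k ∈ p.S → i = k) := by
    intro k
    by_cases hk : k ∈ p.S
    · exact ⟨k, hk, fun i' _ => (I.dist_self k).le.trans (I.dist_nonneg _ _), fun _ => rfl⟩
    · obtain ⟨i, hi, hmin⟩ := Finset.exists_min_image p.S (I.dist k) hS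
      exact ⟨i, hi, hmin, fun h => absurd h hk⟩
  choose η hη hηmin hηself using hex
  have h1 := Finset.sum_le_sum fun i hi => openCost_le_of_not_efficient hφ h hr η
    (fun k _ => hη k) (fun k _ => hηmin k) (fun k _ => hηself k) (i := i) hi
  rw [← Finset.mul_sum, Finset.sum_add_distrib, ← Finset.mul_sum,
    Finset.sum_fiberwise_of_maps_to (fun k _ => hη k), Finset.sum_fiberwise_of_maps_to hp,
    Finset.sum_add_distrib, Finset.sum_const, nsmul_eq_mul, ← Finset.mul_sum] at h1
  unfold facCost connCost
  linarith

/-- A solution without `φ`-efficient local operations is a `(1 + √2)`-approximation, up to an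
additive error of `(1 + √2) φ` per client. -/
theorem cost_le_of_not_efficient (hφ : 0 ≤ φ) (h : ∀ q, ¬ Efficient I x C φ p q)
    (hp : p.Feasible C) {r : Config F ι} (hr : r.Feasible C) :
    I.cost x C p ≤ (1 + √2) * (I.cost x C r + φ * C.card) := by
  have h1 := connCost_le_of_not_efficient h hr
  have h2 := facCost_le_of_not_efficient hφ h hp hr
  have hs : √2 * √2 = 2 := Real.mul_self_sqrt (by norm_num)
  have hs0 := Real.sqrt_nonneg 2
  -- Halved, this bounds the unscaled facility cost with coefficients 1 and √2. Together with `h1`,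
  -- both costs of `r` get the coefficient 1 + √2; this balance is the purpose of the scaling by √2.
  have h3 := mul_le_mul_of_nonneg_left h2 hs0
  unfold cost
  have e : √2 * (√2 * I.facCost p.S) = 2 * I.facCost p.S := by rw [← mul_assoc, hs]
  have e2 : √2 * (√2 * I.facCost r.S + 2 * I.connCost x C r.σ + 2 * (φ * C.card)) =
      2 * I.facCost r.S + 2 * (√2 * I.connCost x C r.σ) + 2 * (√2 * (φ * C.card)) := by
    rw [mul_add, mul_add, ← mul_assoc, hs]; ring
  rw [e, e2] at h3
  nlinarith

end LocalSearch

/-! ### Effect of local operations; idle facilities; termination -/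

namespace LocalSearch

open FLInstance

variable {F ι : Type*} [DecidableEq F] [DecidableEq ι]

section LocalOp

variable {C R : Finset ι} {p q : Config F ι}

theorem LocalOp.subset (h : LocalOp C p q R) : R ⊆ C := by
  cases h with
  | openOp i _ hR => exact hR
  | closeOp i' hi' σ' _ hR => exact hR ▸ Finset.filter_subset _ _
  | swapOp i i' hi hi' σ' _ hR => exact hR

theorem LocalOp.σ_eq (h : LocalOp C p q R) {j : ι} (hj : j ∉ R) : q.σ j = p.σ j := by
  cases h with
  | openOp i _ hR => exact if_neg hj
  | closeOp i' hi' σ' _ hR h_mem h_eq => exact h_eq j hj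
  | swapOp i i' hi hi' σ' _ hR hR' h_mem h_other h_eq => exact h_eq j hj

theorem LocalOp.feasible (h : LocalOp C p q R) (hp : p.Feasible C) : q.Feasible C := by
  intro j hj
  cases h with
  | openOp i _ hR =>
    dsimp only
    split_ifs
    · exact Finset.mem_insert_self _ _
    · exact Finset.mem_insert_of_mem (hp j hj)
  | closeOp i' hi' σ' _ hR h_mem h_eq =>
    by_cases hjR : j ∈ R
    · exact h_mem j hjR
    · dsimp only
      rw [h_eq j hjR]
      refine Finset.mem_erase.2 ⟨fun hc => hjR ?_, hp j hj⟩
      rw [hR]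
      exact Finset.mem_filter.2 ⟨hj, hc⟩
  | swapOp i i' hi hi' σ' _ hR hR' h_mem h_other h_eq =>
    dsimp only
    by_cases hjR : j ∈ R
    · by_cases hji : p.σ j = i'
      · exact h_mem j hjR hji
      · rw [h_other j hjR hji]
        exact Finset.mem_insert_self _ _
    · rw [h_eq j hjR]
      exact Finset.mem_insert_of_mem
        (Finset.mem_erase.2 ⟨fun hc => hjR (hR' j hj hc), hp j hj⟩)

end LocalOp

variable (I : FLInstance F)

open Classical in
/-- The open facilities that are not in `B`, or are costly and have no client in `C`. -/
noncomputable def idleOrNew (B : Finset F) (C : Finset ι) (p : Config F ι) : Finset F :=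
  p.S.filter fun i => i ∉ B ∨ (0 < I.openCost i ∧ ∀ j ∈ C, p.σ j ≠ i)

open Classical in
/-- The open facilities of positive cost that have no client in `C`. -/
noncomputable def idle (C : Finset ι) (p : Config F ι) : Finset F :=
  p.S.filter fun i => 0 < I.openCost i ∧ ∀ j ∈ C, p.σ j ≠ i

variable {I}

/-- Relative to the set open at the start of a loop nothing is new, so the count starts from the
idle facilities alone. -/
theorem idleOrNew_self (C : Finset ι) (p : Config F ι) : idleOrNew I p.S C p = idle I C p := by
  unfold idleOrNew idle
  refine Finset.filter_congr fun i hi => ?_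
  simp [hi]

theorem sdiff_subset_idleOrNew (B : Finset F) (C : Finset ι) (p : Config F ι) :
    p.S \ B ⊆ idleOrNew I B C p := fun i hi => by
  classical
  exact Finset.mem_filter.2 ⟨(Finset.mem_sdiff.1 hi).1, Or.inl (Finset.mem_sdiff.1 hi).2⟩

variable {x : ι → Client I} {C R : Finset ι} {p q : Config F ι}

/-- A facility that stays open can only become idle by losing a reconnected client. -/
theorem LocalOp.mem_idleOrNew (h : LocalOp C p q R) {B : Finset F} {k : F}
    (hk : k ∈ idleOrNew I B C q) (hkp : k ∈ p.S) : k ∈ idleOrNew I B C p ∪ R.image p.σ := by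
  classical
  obtain ⟨-, hk⟩ := Finset.mem_filter.1 hk
  by_cases hkR : k ∈ R.image p.σ
  · exact Finset.mem_union_right _ hkR
  refine Finset.mem_union_left _ (Finset.mem_filter.2 ⟨hkp, hk.imp_right fun hk => ⟨hk.1, ?_⟩⟩)
  intro j hj hjk
  by_cases hjR : j ∈ R
  · exact hkR (hjk ▸ Finset.mem_image_of_mem _ hjR)
  · exact hk.2 j hj ((h.σ_eq hjR).trans hjk)

/-- If nobody is reconnected, the decrease must come from the facility cost, so an operation that
opens something is a swap closing a costly idle facility: one counted facility is traded for
another. Otherwise at most one facility is new and at most `R.card` become idle, and `R.card + 1 ≤ 2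
* R.card`. -/
theorem LocalOp.card_idleOrNew_le (h : LocalOp C p q R)
    (hlt : I.scaledCost x C q < I.scaledCost x C p) (B : Finset F) :
    (idleOrNew I B C q).card ≤ (idleOrNew I B C p).card + 2 * R.card := by
  classical
  have hconn : R = ∅ → I.connCost x C q.σ = I.connCost x C p.σ := fun hR =>
    I.connCost_congr x fun j _ => h.σ_eq (by simp [hR])
  have hUnion : ((idleOrNew I B C p) ∪ R.image p.σ).card ≤ (idleOrNew I B C p).card + R.card :=
    (Finset.card_union_le _ _).trans (Nat.add_le_add_left Finset.card_image_le _)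
  have general : ∀ i, (∀ k ∈ q.S, k = i ∨ k ∈ p.S) →
      (idleOrNew I B C q).card ≤ (idleOrNew I B C p).card + R.card + 1 := by
    intro i hi
    have hsub : idleOrNew I B C q ⊆ insert i ((idleOrNew I B C p) ∪ R.image p.σ) := by
      intro k hk
      rcases hi k (Finset.mem_filter.1 hk).1 with rfl | hkp
      · exact Finset.mem_insert_self _ _
      · exact Finset.mem_insert_of_mem (h.mem_idleOrNew hk hkp)
    have h1 := Finset.card_le_card hsub
    have h2 := Finset.card_insert_le i ((idleOrNew I B C p) ∪ R.image p.σ)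
    omega
  rcases R.eq_empty_or_nonempty with hR | hR
  · have hc := hconn hR
    unfold scaledCost at hlt
    rw [hc] at hlt
    have hlt' : I.facCost q.S < I.facCost p.S :=
      lt_of_mul_lt_mul_left (by linarith) (Real.sqrt_nonneg 2)
    subst hR
    cases h with
    | openOp i _ hR =>
      exact absurd (I.facCost_mono (Finset.subset_insert i p.S)) (not_le.2 hlt')
    | closeOp i' hi' σ' _ hR h_mem h_eq =>
      have hsub := fun k hk => LocalOp.mem_idleOrNew (I := I) (B := B) (k := k)
        (LocalOp.closeOp p i' hi' σ' ∅ hR h_mem h_eq) hk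
        (Finset.mem_of_mem_erase (Finset.mem_filter.1 hk).1)
      have := Finset.card_le_card hsub
      simpa using this
    | swapOp i i' hi hi' σ' _ hR hR' h_mem h_other h_eq =>
      have hpos : 0 < I.openCost i' := by
        dsimp only at hlt'
        have h1 : I.facCost (insert i (p.S.erase i')) =
            I.openCost i + I.facCost (p.S.erase i') :=
          Finset.sum_insert fun hh => hi (Finset.mem_of_mem_erase hh)
        rw [h1, I.facCost_erase hi'] at hlt'
        linarith [I.openCost_nonneg i]
      have hmem : i' ∈ idleOrNew I B C p := Finset.mem_filter.2
        ⟨hi', Or.inr ⟨hpos, fun j hj hji => absurd (hR' j hj hji) (Finset.notMem_empty j)⟩⟩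
      have hsub : idleOrNew I B C ⟨insert i (p.S.erase i'), σ'⟩ ⊆
          insert i ((idleOrNew I B C p).erase i') := by
        intro k hk
        rcases Finset.mem_insert.1 (Finset.mem_filter.1 hk).1 with rfl | hk'
        · exact Finset.mem_insert_self _ _
        · have := LocalOp.mem_idleOrNew (LocalOp.swapOp p i i' hi hi' σ' ∅ hR hR' h_mem h_other
            h_eq) hk (Finset.mem_of_mem_erase hk')
          rw [Finset.image_empty, Finset.union_empty] at this
          exact Finset.mem_insert_of_mem (Finset.mem_erase.2 ⟨Finset.ne_of_mem_erase hk', this⟩)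
      have h1 := Finset.card_le_card hsub
      have h2 := Finset.card_insert_le i ((idleOrNew I B C p).erase i')
      have h3 := Finset.card_erase_add_one hmem
      omega
  · have hpos := Finset.card_pos.2 hR
    have : (idleOrNew I B C q).card ≤ (idleOrNew I B C p).card + R.card + 1 := by
      cases h with
      | openOp i _ hR => exact general i fun k hk => Finset.mem_insert.1 hk
      | closeOp i' hi' σ' _ hR h_mem h_eq =>
        exact general i' fun k hk => Or.inr (Finset.mem_of_mem_erase hk)
      | swapOp i i' hi hi' σ' _ hR hR' h_mem h_other h_eq =>
        exact general i fun k hk => (Finset.mem_insert.1 hk).imp_right Finset.mem_of_mem_erase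
    omega

theorem threshold_nonneg {ε' : ℝ} (hε : 0 ≤ ε') (x : ι → Client I) (C : Finset ι)
    (p : Config F ι) : 0 ≤ threshold I ε' x C p := by
  have := I.cost_nonneg x C p
  unfold threshold
  positivity

theorem Improve.scaledCost_lt {ε' : ℝ} (hε : 0 ≤ ε') (h : Improve I ε' x C p q) :
    I.scaledCost x C q < I.scaledCost x C p := by
  obtain ⟨R, -, h⟩ := h
  have := mul_nonneg (threshold_nonneg hε x C p) (Nat.cast_nonneg (α := ℝ) R.card)
  linarith

/-- What a run of the local search loop from `p` to `q` can do with `N` reconnections in total. -/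
structure Run (θ : ℝ) (x : ι → Client I) (C : Finset ι) (p q : Config F ι) (N : ℕ) : Prop where
  mul_le : θ * N ≤ I.scaledCost x C p - I.scaledCost x C q
  eq_zero : I.scaledCost x C p ≤ I.scaledCost x C q → N = 0
  changed : ∃ R ⊆ C, R.card ≤ N ∧ ∀ j, j ∉ R → q.σ j = p.σ j
  card_idleOrNew : ∀ B, (idleOrNew I B C q).card ≤ (idleOrNew I B C p).card + 2 * N
  feasible : q.Feasible C

/-- The thresholds vary with the cost during the loop; a common lower bound `a` on the cost of
feasible solutions makes them uniform. If `a = 0`, the bound on `N` is void and only strict decrease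
remains, which is recorded as `eq_zero`. -/
theorem exists_run {ε' a : ℝ} (hε : 0 ≤ ε')
    (ha : ∀ r : Config F ι, r.Feasible C → a ≤ I.cost x C r) (hp : p.Feasible C)
    (h : Relation.ReflTransGen (Improve I ε' x C) p q) :
    I.scaledCost x C q ≤ I.scaledCost x C p ∧
      ∃ N, Run (ε' * a / ((1 + √2) * C.card)) x C p q N := by
  induction h with
  | refl => exact ⟨le_rfl, 0, ⟨by simp, fun _ => rfl, ⟨∅, by simp, by simp, by simp⟩, by simp, hp⟩⟩
  | @tail r s _ hrs ih =>
    obtain ⟨hle, N, hN⟩ := ih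
    have hlt := hrs.scaledCost_lt hε
    obtain ⟨R, hop, hR⟩ := hrs
    refine ⟨hlt.le.trans hle, N + R.card, ?_, fun h => absurd (hlt.trans_le hle) (not_lt.2 h), ?_,
      fun B => ?_, hop.feasible hN.feasible⟩
    · have h1 : ε' * a / ((1 + √2) * C.card) ≤ threshold I ε' x C r := by
        unfold threshold
        have := ha r hN.feasible
        gcongr
      have h2 := mul_le_mul_of_nonneg_right h1 (Nat.cast_nonneg (α := ℝ) R.card)
      have h3 := hN.mul_le
      push_cast
      rw [mul_add]
      linarith
    · obtain ⟨R', hR'C, hR'N, hR'⟩ := hN.changed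
      refine ⟨R' ∪ R, Finset.union_subset hR'C hop.subset,
        (Finset.card_union_le _ _).trans (Nat.add_le_add_right hR'N _), fun j hj => ?_⟩
      rw [Finset.mem_union, not_or] at hj
      exact (hop.σ_eq hj.2).trans (hR' j hj.1)
    · have h1 := hop.card_idleOrNew_le hlt B
      have h2 := hN.card_idleOrNew B
      omega

/-- Closing an idle facility reconnects nobody, so any positive saving would already be efficient.
-/
theorem idle_eq_empty_of_not_efficient {φ : ℝ} (h : ∀ q', ¬ Efficient I x C φ q q') :
    idle I C q = ∅ := by
  classical
  rw [Finset.eq_empty_iff_forall_notMem]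
  intro i hi
  obtain ⟨hiS, hpos, hemp⟩ := Finset.mem_filter.1 hi
  have h1 := close_inequality h hiS q.σ fun j hj hji => absurd hji (hemp j hj)
  rw [Finset.filter_false_of_mem hemp, Finset.sum_empty] at h1
  have := one_le_sqrt_two
  nlinarith

/-- The local search loop terminates: there are finitely many solutions and every iteration
decreases the scaled cost. -/
theorem exists_settles [Finite F] [Finite ι] {ε' : ℝ} (hε : 0 ≤ ε') (x : ι → Client I)
    (C : Finset ι) (p : Config F ι) : ∃ q, Settles I ε' x C p q := by
  have : Finite (Config F ι) :=
    Finite.of_injective (fun r : Config F ι => (r.S, r.σ)) fun r s h =>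
      Config.ext (Prod.ext_iff.1 h).1 (Prod.ext_iff.1 h).2
  obtain ⟨q, hq, hmin⟩ := Set.exists_min_image {q | Relation.ReflTransGen (Improve I ε' x C) p q}
    (I.scaledCost x C) (Set.toFinite _) ⟨p, .refl⟩
  exact ⟨q, hq, fun q' h => absurd (hmin q' (Relation.ReflTransGen.tail hq h))
    (not_le.2 (h.scaledCost_lt hε))⟩

/-! ### Arrival of a client -/

section InitialConnect

theorem exists_initialConnect [Finite F] [Nonempty F] (y : Client I) (S : Finset F) :
    ∃ S' i, InitialConnect y S S' i := by
  have := Fintype.ofFinite F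
  by_cases hnew : ∃ i, i ∉ S ∧ ∀ k ∈ S, I.openCost i + y.dist i < y.dist k
  · obtain ⟨i₁, hi₁, hlt₁⟩ := hnew
    obtain ⟨i, hi, hmin⟩ := Finset.exists_min_image Sᶜ (fun i => I.openCost i + y.dist i)
      ⟨i₁, Finset.mem_compl.2 hi₁⟩
    exact ⟨_, i, .openNew i (Finset.mem_compl.1 hi) (fun k hk => hmin k (Finset.mem_compl.2 hk))
      fun k hk => (hmin i₁ (Finset.mem_compl.2 hi₁)).trans_lt (hlt₁ k hk)⟩
  · push Not at hnew
    have hS : S.Nonempty := by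
      by_contra hS
      rw [Finset.not_nonempty_iff_eq_empty] at hS
      obtain ⟨k, hk, -⟩ := hnew (Classical.arbitrary F) (by simp [hS])
      simp [hS] at hk
    obtain ⟨i, hi, hmin⟩ := Finset.exists_min_image S y.dist hS
    refine ⟨S, i, .useOpen i hi hmin fun k hk => ?_⟩
    obtain ⟨k', hk', hle⟩ := hnew k hk
    exact (hmin k' hk').trans hle

variable {y : Client I} {S S' : Finset F} {i : F}

theorem InitialConnect.mem (h : InitialConnect y S S' i) : i ∈ S' := by
  cases h with
  | openNew _ hi => exact Finset.mem_insert_self _ _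
  | useOpen _ hi => exact hi

theorem InitialConnect.subset (h : InitialConnect y S S' i) : S ⊆ S' := by
  cases h with
  | openNew _ hi => exact Finset.subset_insert _ _
  | useOpen _ hi => exact subset_rfl

theorem InitialConnect.subset_insert (h : InitialConnect y S S' i) : S' ⊆ insert i S := by
  cases h with
  | openNew _ hi => exact subset_rfl
  | useOpen _ hi => exact Finset.subset_insert _ _

/-- The increase of the scaled cost caused by connecting a new client. -/
noncomputable def increase (y : Client I) (S S' : Finset F) (i : F) : ℝ :=
  √2 * (I.facCost S' - I.facCost S) + y.dist i

/-- A facility is newly opened only if opening plus connection is cheaper than every open facility;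
the factor √2 pays for the scaled opening cost. Used with the facility of an earlier client as `k`.
-/
theorem InitialConnect.increase_le_of_mem (h : InitialConnect y S S' i) {k : F} (hk : k ∈ S) :
    increase y S S' i ≤ √2 * y.dist k := by
  have h2 := one_le_sqrt_two
  have h0 := y.dist_nonneg i
  unfold increase
  cases h with
  | openNew _ hi h_min h_lt =>
    have h1 : I.facCost (insert i S) = I.openCost i + I.facCost S := Finset.sum_insert hi
    have h3 := h_lt k hk
    rw [h1]
    nlinarith
  | useOpen _ hi h_min h_le =>
    have h3 := h_min k hk
    rw [sub_self, mul_zero, zero_add]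
    nlinarith

theorem InitialConnect.increase_le (h : InitialConnect y S S' i) (k : F) :
    increase y S S' i ≤ √2 * (I.openCost k + y.dist k) := by
  have h2 := one_le_sqrt_two
  have h0 := y.dist_nonneg i
  by_cases hk : k ∈ S
  · refine (h.increase_le_of_mem hk).trans ?_
    have := I.openCost_nonneg k
    gcongr
    linarith
  unfold increase
  cases h with
  | openNew _ hi h_min h_lt =>
    have h1 : I.facCost (insert i S) = I.openCost i + I.facCost S := Finset.sum_insert hi
    have h3 := h_min k hk
    rw [h1]
    nlinarith
  | useOpen _ hi h_min h_le =>
    have h3 := h_le k hk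
    rw [sub_self, mul_zero, zero_add]
    nlinarith

end InitialConnect

section Arrival

variable {S' : Finset F} {t : ι} {i : F}

theorem connCost_update (x : ι → Client I) (ht : t ∉ C) (σ : ι → F) (i : F) :
    I.connCost x (insert t C) (Function.update σ t i) = (x t).dist i + I.connCost x C σ := by
  unfold connCost
  rw [Finset.sum_insert ht, Function.update_self]
  congr 1
  refine Finset.sum_congr rfl fun j hj => ?_
  rw [Function.update_of_ne (ne_of_mem_of_not_mem hj ht)]

theorem scaledCost_arrival (ht : t ∉ C) :
    I.scaledCost x (insert t C) ⟨S', Function.update p.σ t i⟩ =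
      I.scaledCost x C p + increase (x t) p.S S' i := by
  unfold scaledCost increase
  dsimp only
  rw [connCost_update x ht]
  ring

theorem InitialConnect.feasible (h : InitialConnect (x t) p.S S' i)
    (hp : p.Feasible C) :
    Config.Feasible (insert t C) ⟨S', Function.update p.σ t i⟩ := by
  intro j hj
  dsimp only
  by_cases hjt : j = t
  · subst hjt
    rw [Function.update_self]
    exact h.mem
  · rw [Function.update_of_ne hjt]
    exact h.subset (hp j (Finset.mem_of_mem_insert_of_ne hj hjt))

/-- The only facility that can be new serves the arriving client. -/
theorem InitialConnect.idle_subset (h : InitialConnect (x t) p.S S' i) (ht : t ∉ C) :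
    idle I (insert t C) ⟨S', Function.update p.σ t i⟩ ⊆ idle I C p := by
  classical
  intro k hk
  obtain ⟨hkS, hpos, hk⟩ := Finset.mem_filter.1 hk
  have hki : k ≠ i := by
    rintro rfl
    exact hk t (Finset.mem_insert_self _ _) (Function.update_self _ _ _)
  refine Finset.mem_filter.2 ⟨Finset.mem_of_mem_insert_of_ne (h.subset_insert hkS) hki, hpos,
    fun j hj hjk => hk j (Finset.mem_insert_of_mem hj) ?_⟩
  dsimp only
  rw [Function.update_of_ne (ne_of_mem_of_not_mem hj ht), hjk]

end Arrival

end LocalSearch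

/-! ### Transfer to clients indexed by natural numbers -/

namespace LocalSearch

open FLInstance

section Extend

variable {F : Type*} {t : ℕ}

/-- Extension of the connections of the first `t` clients to a common index set of all clients. -/
def extend (d : F) (σ : Fin t → F) : ℕ → F := fun j => if h : j < t then σ ⟨j, h⟩ else d

theorem extend_val (d : F) (σ : Fin t → F) (j : Fin t) : extend d σ j = σ j := by
  simp [extend]

theorem extend_of_not_lt (d : F) (σ : Fin t → F) {j : ℕ} (hj : ¬ j < t) : extend d σ j = d :=
  dif_neg hj

/-- Extension of a solution to the index set of all clients. -/
def extendConfig (d : F) (p : Config F (Fin t)) : Config F ℕ := ⟨p.S, extend d p.σ⟩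

theorem extend_restrict {d : F} {σ : ℕ → F} (h : ∀ j, ¬ j < t → σ j = d) :
    extend d (fun j : Fin t => σ j) = σ := by
  funext j
  by_cases hj : j < t
  · exact dif_pos hj
  · rw [extend_of_not_lt d _ hj, h j hj]

theorem extend_snoc (d : F) (σ : Fin t → F) (i : F) :
    extend d (Fin.snoc (α := fun _ => F) σ i : Fin (t + 1) → F) =
      Function.update (extend d σ) t i := by
  funext j
  rcases lt_trichotomy j t with hj | rfl | hj
  · rw [Function.update_of_ne hj.ne]
    have h1 := extend_val d (Fin.snoc (α := fun _ => F) σ i : Fin (t + 1) → F)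
      (Fin.castSucc ⟨j, hj⟩)
    rw [Fin.snoc_castSucc] at h1
    have h2 := extend_val d σ ⟨j, hj⟩
    exact h1.trans h2.symm
  · rw [Function.update_self]
    have h1 := extend_val d (Fin.snoc (α := fun _ => F) σ i : Fin (j + 1) → F) (Fin.last j)
    rw [Fin.snoc_last] at h1
    exact h1
  · rw [Function.update_of_ne hj.ne', extend_of_not_lt, extend_of_not_lt] <;> omega

theorem val_mem_map {C : Finset (Fin t)} {j : Fin t} :
    (j : ℕ) ∈ C.map Fin.valEmbedding ↔ j ∈ C :=
  Finset.mem_map' Fin.valEmbedding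

theorem map_insert_last (C : Finset (Fin t)) :
    (insert (Fin.last t) (C.map Fin.castSuccEmb)).map Fin.valEmbedding =
      insert t (C.map Fin.valEmbedding) := by
  rw [Finset.map_insert, Finset.map_map]
  rfl

theorem map_castSucc (C : Finset (Fin t)) :
    (C.map Fin.castSuccEmb).map Fin.valEmbedding = C.map Fin.valEmbedding := by
  rw [Finset.map_map]
  rfl

variable {I : FLInstance F} (y : ℕ → Client I)

theorem connCost_extend (d : F) (C : Finset (Fin t)) (σ : Fin t → F) :
    I.connCost y (C.map Fin.valEmbedding) (extend d σ) =
      I.connCost (fun j : Fin t => y j) C σ := by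
  unfold connCost
  rw [Finset.sum_map]
  refine Finset.sum_congr rfl fun j _ => ?_
  rw [Fin.valEmbedding_apply, extend_val]

theorem cost_extend (d : F) (C : Finset (Fin t)) (p : Config F (Fin t)) :
    I.cost y (C.map Fin.valEmbedding) (extendConfig d p) =
      I.cost (fun j : Fin t => y j) C p :=
  congrArg (I.facCost p.S + ·) (connCost_extend y d C p.σ)

theorem scaledCost_extend (d : F) (C : Finset (Fin t)) (p : Config F (Fin t)) :
    I.scaledCost y (C.map Fin.valEmbedding) (extendConfig d p) =
      I.scaledCost (fun j : Fin t => y j) C p :=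
  congrArg (√2 * I.facCost p.S + ·) (connCost_extend y d C p.σ)

variable [DecidableEq F]

theorem LocalOp.extend {C R : Finset (Fin t)} {p q : Config F (Fin t)} (h : LocalOp C p q R)
    (d : F) :
    LocalOp (C.map Fin.valEmbedding) (extendConfig d p) (extendConfig d q)
      (R.map Fin.valEmbedding) := by
  have hsub : R.map Fin.valEmbedding ⊆ C.map Fin.valEmbedding := Finset.map_subset_map.2 h.subset
  have hout : ∀ j, j ∉ R.map Fin.valEmbedding →
      LocalSearch.extend d q.σ j = LocalSearch.extend d p.σ j := by
    intro j hj
    by_cases hjt : j < t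
    · have := h.σ_eq (j := ⟨j, hjt⟩) fun hh => hj (val_mem_map.2 hh)
      simpa [LocalSearch.extend, hjt] using this
    · rw [extend_of_not_lt d _ hjt, extend_of_not_lt d _ hjt]
  cases h with
  | openOp i _ hR =>
    convert LocalOp.openOp (extendConfig d p) i (R.map Fin.valEmbedding) hsub using 1
    refine Config.ext rfl (funext fun j => ?_)
    by_cases hj : j ∈ R.map Fin.valEmbedding
    · obtain ⟨k, hk, rfl⟩ := Finset.mem_map.1 hj
      dsimp only
      rw [if_pos hj]
      exact (extend_val d _ k).trans (if_pos hk)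
    · dsimp only
      rw [if_neg hj]
      exact hout j hj
  | closeOp i' hi' σ' _ hR h_mem h_eq =>
    refine LocalOp.closeOp (extendConfig d p) i' hi' (LocalSearch.extend d σ')
      (R.map Fin.valEmbedding) ?_ ?_ hout
    · ext j
      constructor
      · intro hj
        obtain ⟨k, hk, rfl⟩ := Finset.mem_map.1 hj
        rw [hR] at hk
        exact Finset.mem_filter.2 ⟨hsub hj, (extend_val d _ k).trans (Finset.mem_filter.1 hk).2⟩
      · intro hj
        obtain ⟨hjC, hji⟩ := Finset.mem_filter.1 hj
        obtain ⟨k, hk, rfl⟩ := Finset.mem_map.1 hjC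
        refine val_mem_map.2 ?_
        rw [hR]
        exact Finset.mem_filter.2 ⟨hk, (extend_val d p.σ k).symm.trans hji⟩
    · intro j hj
      obtain ⟨k, hk, rfl⟩ := Finset.mem_map.1 hj
      rw [Fin.valEmbedding_apply, extend_val]
      exact h_mem k hk
  | swapOp i i' hi hi' σ' _ hR hR' h_mem h_other h_eq =>
    refine LocalOp.swapOp (extendConfig d p) i i' hi hi' (LocalSearch.extend d σ')
      (R.map Fin.valEmbedding) hsub ?_ ?_ ?_ hout
    · intro j hj hji
      obtain ⟨k, hk, rfl⟩ := Finset.mem_map.1 hj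
      exact val_mem_map.2 (hR' k hk ((extend_val d p.σ k).symm.trans hji))
    · intro j hj hji
      obtain ⟨k, hk, rfl⟩ := Finset.mem_map.1 hj
      rw [Fin.valEmbedding_apply, extend_val]
      exact h_mem k hk ((extend_val d p.σ k).symm.trans hji)
    · intro j hj hji
      obtain ⟨k, hk, rfl⟩ := Finset.mem_map.1 hj
      rw [Fin.valEmbedding_apply, extend_val]
      exact h_other k hk fun hh => hji ((extend_val d p.σ k).trans hh)

/-- Operations touch only current clients, all of which have index below `t`, so extension creates
no new operations. This direction is needed to transfer that local search has stopped. -/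
theorem LocalOp.exists_of_extend {C : Finset (Fin t)} {p : Config F (Fin t)} {d : F}
    {r : Config F ℕ} {R' : Finset ℕ}
    (h : LocalOp (C.map Fin.valEmbedding) (extendConfig d p) r R') :
    ∃ q R, r = extendConfig d q ∧ R' = R.map Fin.valEmbedding ∧ LocalOp C p q R := by
  obtain ⟨R, hRC, rfl⟩ := Finset.subset_map_iff.1 h.subset
  have hr : extendConfig d ⟨r.S, fun j : Fin t => r.σ j⟩ = r := by
    refine Config.ext rfl (extend_restrict fun j hj => ?_)
    refine (h.σ_eq fun hh => ?_).trans (extend_of_not_lt d _ hj)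
    obtain ⟨k, -, rfl⟩ := Finset.mem_map.1 hh
    exact hj k.isLt
  refine ⟨_, R, hr.symm, rfl, ?_⟩
  have hval : ∀ k : Fin t, (extendConfig d p).σ k = p.σ k := extend_val d p.σ
  have hout : ∀ k : Fin t, k ∉ R → r.σ k = p.σ k := fun k hk =>
    (h.σ_eq fun hh => hk (val_mem_map.1 hh)).trans (hval k)
  clear hr
  generalize hRR : R.map Fin.valEmbedding = RR at h
  have hmem : ∀ k : Fin t, (k : ℕ) ∈ RR ↔ k ∈ R := fun k => hRR ▸ val_mem_map
  cases h with
  | openOp i _ hR =>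
    convert LocalOp.openOp p i R hRC using 1
    refine Config.ext rfl (funext fun k => ?_)
    dsimp only
    simp only [hmem, hval]
  | closeOp i' hi' σ' _ hR h_mem h_eq =>
    refine LocalOp.closeOp p i' hi' (fun k : Fin t => σ' k) R ?_
      (fun k hk => h_mem k ((hmem k).2 hk)) hout
    ext k
    rw [← hmem, hR, Finset.mem_filter, Finset.mem_filter, val_mem_map, hval]
  | swapOp i i' hi hi' σ' _ hR hR' h_mem h_other h_eq =>
    exact LocalOp.swapOp p i i' hi hi' (fun k : Fin t => σ' k) R hRC
      (fun k hk hki => (hmem k).1 (hR' k (val_mem_map.2 hk) ((hval k).trans hki)))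
      (fun k hk hki => h_mem k ((hmem k).2 hk) ((hval k).trans hki))
      (fun k hk hki => h_other k ((hmem k).2 hk) fun hh => hki ((hval k).symm.trans hh)) hout

variable {y} {ε' : ℝ} {C : Finset (Fin t)} {p q : Config F (Fin t)}

theorem threshold_extend (d : F) :
    threshold I ε' y (C.map Fin.valEmbedding) (extendConfig d p) =
      threshold I ε' (fun j : Fin t => y j) C p := by
  unfold threshold
  rw [cost_extend, Finset.card_map]

theorem Improve.extend (h : Improve I ε' (fun j : Fin t => y j) C p q) (d : F) :
    Improve I ε' y (C.map Fin.valEmbedding) (extendConfig d p) (extendConfig d q) := by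
  obtain ⟨R, hop, hlt⟩ := h
  refine ⟨R.map Fin.valEmbedding, hop.extend d, ?_⟩
  rwa [threshold_extend, scaledCost_extend, scaledCost_extend, Finset.card_map]

theorem Settles.extend (h : Settles I ε' (fun j : Fin t => y j) C p q) (d : F) :
    Settles I ε' y (C.map Fin.valEmbedding) (extendConfig d p) (extendConfig d q) := by
  refine ⟨Relation.ReflTransGen.lift (p := Improve I ε' y (C.map Fin.valEmbedding))
    (extendConfig d) (fun _ _ hab => Improve.extend hab d) _ _ h.1, fun r hr => ?_⟩
  obtain ⟨R', hop, hlt⟩ := hr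
  obtain ⟨q', R, rfl, rfl, hop'⟩ := hop.exists_of_extend
  refine h.2 q' ⟨R, hop', ?_⟩
  rwa [threshold_extend, scaledCost_extend, scaledCost_extend, Finset.card_map] at hlt

end Extend

/-- The internal state of the algorithm, with clients indexed by their arrival times. -/
structure Snapshot (F : Type*) where
  C : Finset ℕ
  cur : Config F ℕ
  C₀ : Finset ℕ
  start : Config F ℕ
  frozen : Finset F

variable {F : Type*} [DecidableEq F] {I : FLInstance F}

/-- The state after an arrival at which the stage does not end, if local search stops at `q`. -/
def Snapshot.continue (s : Snapshot F) (t : ℕ) (i : F) (q : Config F ℕ) : Snapshot F :=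
  { C := insert t s.C, cur := q, C₀ := s.C₀, start := ⟨s.start.S, Function.update s.start.σ t i⟩,
    frozen := s.frozen }

/-- The connections after an arrival that ends the stage, if local search stops at `q`. -/
def Snapshot.freezeConfig (s : Snapshot F) (t : ℕ) (i : F) (q : Config F ℕ) : Config F ℕ :=
  ⟨q.S, fun j => if j ∈ s.C₀ then Function.update s.start.σ t i j else q.σ j⟩

/-- The state after an arrival that ends the stage, if local search stops at `q`. -/
def Snapshot.freeze (s : Snapshot F) (t : ℕ) (i : F) (q : Config F ℕ) : Snapshot F :=
  { C := insert t s.C \ s.C₀, cur := s.freezeConfig t i q, C₀ := insert t s.C \ s.C₀,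
    start := s.freezeConfig t i q, frozen := s.frozen ∪ s.start.S }

/-- One time of the algorithm in terms of snapshots: client `t` is connected to `i`, local search
stops at `q`, and the stage ends or goes on. -/
structure Transition (ε' : ℝ) (y : ℕ → Client I) (t : ℕ) (s s' : Snapshot F) (S' : Finset F)
    (i : F) (q : Config F ℕ) : Prop where
  connect : InitialConnect (y t) s.cur.S S' i
  settles : Settles I ε' y (insert t s.C) ⟨S', Function.update s.cur.σ t i⟩ q
  next : (I.cost y (insert t s.C) q ≤
        I.cost y s.C₀ ⟨s.start.S, Function.update s.start.σ t i⟩ / ε' ∧ s' = s.continue t i q) ∨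
      (I.cost y s.C₀ ⟨s.start.S, Function.update s.start.σ t i⟩ / ε' <
        I.cost y (insert t s.C) q ∧ s' = s.freeze t i q)

/-- The snapshot of an internal state. -/
def State.snapshot (d : F) {t : ℕ} (s : State F t) : Snapshot F :=
  { C := s.C.map Fin.valEmbedding, cur := extendConfig d s.cur, C₀ := s.C₀.map Fin.valEmbedding,
    start := extendConfig d s.start, frozen := s.frozen }

/-- After this, clients keep one index for all time, and states at different times can be compared
without casts. The default `d` sits only at indices that have not arrived. -/
theorem Step.exists_transition {ε' : ℝ} {y : ℕ → Client I} {t : ℕ} {s : State F t}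
    {s' : State F (t + 1)} (h : Step ε' (fun j : Fin (t + 1) => y j) s s') (d : F) :
    ∃ S' i q, Transition ε' y t (s.snapshot d) (s'.snapshot d) S' i q := by
  obtain ⟨S', i, q, hconn, hsettles, rfl⟩ := h
  have hstart : extendConfig d ⟨s.start.S, Fin.snoc (α := fun _ => F) s.start.σ i⟩ =
      ⟨(s.snapshot d).start.S, Function.update (s.snapshot d).start.σ t i⟩ :=
    Config.ext rfl (extend_snoc d _ _)
  refine ⟨S', i, extendConfig d q, hconn, ?_, ?_⟩
  · have h1 := hsettles.extend d
    rw [map_insert_last] at h1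
    have h2 : extendConfig d ⟨S', Fin.snoc (α := fun _ => F) s.cur.σ i⟩ =
        ⟨S', Function.update (s.snapshot d).cur.σ t i⟩ := Config.ext rfl (extend_snoc d _ _)
    rwa [h2] at h1
  · have hc1 := cost_extend y d (insert (Fin.last t) (s.C.map Fin.castSuccEmb)) q
    have hc2 := cost_extend y d (s.C₀.map Fin.castSuccEmb)
      ⟨s.start.S, Fin.snoc (α := fun _ => F) s.start.σ i⟩
    rw [map_insert_last] at hc1
    rw [map_castSucc, hstart] at hc2
    unfold finish
    split_ifs with hc
    · refine Or.inr ⟨?_, ?_⟩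
      · rw [← hc1, ← hc2] at hc
        exact hc
      · have hfr : extendConfig d ⟨q.S, fun j => if j ∈ s.C₀.map Fin.castSuccEmb then
            (Fin.snoc (α := fun _ => F) s.start.σ i : Fin (t + 1) → F) j else q.σ j⟩ =
            (s.snapshot d).freezeConfig t i (extendConfig d q) := by
          refine Config.ext rfl (funext fun j => ?_)
          have hσ : extend d (Fin.snoc (α := fun _ => F) s.start.σ i : Fin (t + 1) → F) =
            Function.update (s.snapshot d).start.σ t i := extend_snoc d _ _
          have hm : ∀ j : ℕ, j ∈ (s.snapshot d).C₀ ↔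
              j ∈ (s.C₀.map Fin.castSuccEmb).map Fin.valEmbedding := fun j => by
            rw [map_castSucc]; rfl
          unfold Snapshot.freezeConfig
          dsimp only
          simp only [← hσ, hm]
          by_cases hj : j < t + 1
          · have e : ∀ τ : Fin (t + 1) → F, extend d τ j = τ ⟨j, hj⟩ := fun τ => dif_pos hj
            change extend d _ j = if _ then _ else extend d q.σ j
            rw [e, e, e]
            have := val_mem_map (C := s.C₀.map Fin.castSuccEmb) (j := ⟨j, hj⟩)
            dsimp only at this ⊢
            simp only [this]
          · have e : ∀ τ : Fin (t + 1) → F, extend d τ j = d := fun τ => dif_neg hj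
            change extend d _ j = if _ then _ else extend d q.σ j
            rw [e, e, e, ite_self]
        have hC : (insert (Fin.last t) (s.C.map Fin.castSuccEmb) \ s.C₀.map Fin.castSuccEmb).map
            Fin.valEmbedding = insert t (s.snapshot d).C \ (s.snapshot d).C₀ := by
          rw [Finset.map_sdiff, map_insert_last, map_castSucc]
          rfl
        unfold State.snapshot Snapshot.freeze
        dsimp only
        rw [hfr, hC]
        rfl
    · refine Or.inl ⟨?_, ?_⟩
      · rw [not_lt, ← hc1, ← hc2] at hc
        exact hc
      · unfold State.snapshot Snapshot.continue
        dsimp only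
        rw [map_insert_last, map_castSucc, hstart]
        rfl

end LocalSearch

/-! ### The optimum for a set of clients -/

namespace FLInstance

section Optimum

variable {F ι : Type*} {I : FLInstance F}

/-- The optimum cost for the clients in `C`. -/
noncomputable def optOn (x : ι → Client I) (C : Finset ι) : ℝ :=
  ⨅ p : {p : Config F ι // ∀ j, p.σ j ∈ p.S}, I.cost x C p

variable (x : ι → Client I) {C C' : Finset ι}

theorem bddBelow_cost (C : Finset ι) :
    BddBelow (Set.range fun p : {p : Config F ι // ∀ j, p.σ j ∈ p.S} => I.cost x C p) :=
  ⟨0, by rintro _ ⟨p, rfl⟩; exact I.cost_nonneg x C p⟩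

theorem optOn_nonneg (C : Finset ι) : 0 ≤ optOn x C :=
  Real.iInf_nonneg fun p => I.cost_nonneg x C p

/-- Indices outside `C` are redirected to the facility of some client of `C`. For empty `C` the
bound may fail: `p` may then have no open facility, while `optOn` ranges over assignments of all of
`ι` to open facilities. -/
theorem optOn_le {p : Config F ι} (hp : p.Feasible C) (hC : C.Nonempty) :
    optOn x C ≤ I.cost x C p := by
  classical
  obtain ⟨j₀, hj₀⟩ := hC
  have h := ciInf_le (bddBelow_cost x C) ⟨⟨p.S, fun j => if j ∈ C then p.σ j else p.σ j₀⟩,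
    fun j => by
      dsimp only
      split_ifs with hj
      exacts [hp j hj, hp j₀ hj₀]⟩
  refine h.trans (le_of_eq ?_)
  exact congrArg (I.facCost p.S + ·) (I.connCost_congr x fun j hj => if_pos hj)

variable [Nonempty F]

instance : Nonempty {p : Config F ι // ∀ j, p.σ j ∈ p.S} :=
  ⟨⟨⟨{Classical.arbitrary F}, fun _ => Classical.arbitrary F⟩, fun _ => Finset.mem_singleton_self _⟩⟩

/-- Lets estimates against arbitrary solutions pass to the infimum without an optimal solution
having to be exhibited. -/
theorem le_mul_optOn {a b α : ℝ} (hα : 0 ≤ α)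
    (h : ∀ p : Config F ι, (∀ j, p.σ j ∈ p.S) → a ≤ b + α * I.cost x C p) :
    a ≤ b + α * optOn x C := by
  unfold optOn
  rw [Real.mul_iInf_of_nonneg hα]
  have := le_ciInf fun p : {p : Config F ι // ∀ j, p.σ j ∈ p.S} =>
    sub_le_iff_le_add'.2 (h p p.2)
  linarith

theorem optOn_mono (h : C ⊆ C') : optOn x C ≤ optOn x C' :=
  ciInf_mono (bddBelow_cost x C) fun p => I.cost_mono x h p

/-- The union of a solution for `C₀` and one for the remaining clients is a solution for `C`. At the
end of a stage this shows that dropping the cheap clients `C₀` hardly lowers the optimum. -/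
theorem optOn_le_add [DecidableEq F] [DecidableEq ι] {p : Config F ι} {C₀ : Finset ι}
    (hp : p.Feasible C₀) (hC₀ : C₀ ⊆ C) :
    optOn x C ≤ I.cost x C₀ p + optOn x (C \ C₀) := by
  have h := le_mul_optOn x (C := C \ C₀) (a := optOn x C) (b := I.cost x C₀ p) zero_le_one
    fun r hr => ?_
  · rwa [one_mul] at h
  have h1 := ciInf_le (bddBelow_cost x C) ⟨⟨p.S ∪ r.S, fun j => if j ∈ C₀ then p.σ j else r.σ j⟩,
    fun j => by
      dsimp only
      split_ifs with hj
      exacts [Finset.mem_union_left _ (hp j hj), Finset.mem_union_right _ (hr j)]⟩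
  refine h1.trans ?_
  have h2 := I.facCost_union_le p.S r.S
  have h3 : I.connCost x C (fun j => if j ∈ C₀ then p.σ j else r.σ j) =
      I.connCost x (C \ C₀) r.σ + I.connCost x C₀ p.σ := by
    have e1 : I.connCost x C₀ p.σ = I.connCost x C₀ (fun j => if j ∈ C₀ then p.σ j else r.σ j) :=
      I.connCost_congr x fun j hj => (if_pos hj).symm
    have e2 : I.connCost x (C \ C₀) r.σ =
        I.connCost x (C \ C₀) (fun j => if j ∈ C₀ then p.σ j else r.σ j) :=
      I.connCost_congr x fun j hj => (if_neg (Finset.mem_sdiff.1 hj).2).symm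
    rw [e1, e2]
    exact (Finset.sum_sdiff hC₀).symm
  unfold cost
  dsimp only
  rw [h3]
  linarith

end Optimum

theorem connCost_sdiff_add {F ι : Type*} [DecidableEq ι] (I : FLInstance F) (x : ι → Client I)
    {C C' : Finset ι} (h : C ⊆ C') (σ : ι → F) :
    I.connCost x (C' \ C) σ + I.connCost x C σ = I.connCost x C' σ :=
  Finset.sum_sdiff h

end FLInstance

/-! ### Invariants of the staged algorithm and its cost -/

namespace LocalSearch

open FLInstance

theorem one_add_sqrt_two_le : 1 + √2 ≤ (121 / 50 : ℝ) := by
  have : √2 ≤ 71 / 50 := by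
    rw [Real.sqrt_le_left (by norm_num)]; norm_num
  linarith

/-- What holds for every snapshot that the algorithm reaches. -/
structure Snapshot.Valid {F : Type*} [DecidableEq F] {I : FLInstance F} (ε' : ℝ)
    (y : ℕ → Client I) (t : ℕ) (s : Snapshot F) : Prop where
  subset_range : s.C ⊆ Finset.range t
  C₀_subset : s.C₀ ⊆ s.C
  nonempty : 0 < t → s.C.Nonempty
  cur_feasible : s.cur.Feasible s.C
  start_feasible : s.start.Feasible s.C₀
  mem_frozen : ∀ j ∈ Finset.range t \ s.C, s.cur.σ j ∈ s.frozen
  frozen_le : I.facCost s.frozen + I.connCost y (Finset.range t \ s.C) s.cur.σ ≤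
    4 * ε' * I.cost y s.C₀ s.start
  start_le : I.cost y s.C₀ s.start ≤ 3 * optOn y s.C₀
  cur_le : I.cost y s.C s.cur ≤ 3 * optOn y s.C
  cur_le_start : I.cost y s.C s.cur ≤ I.cost y s.C₀ s.start / ε'
  open_inequality : ∀ k, ∀ R ⊆ s.C, ∑ j ∈ R, (y j).dist (s.cur.σ j) ≤
    √2 * I.openCost k + ∑ j ∈ R, (y j).dist k + optOn y s.C / s.C.card * R.card
  optOn_pos : 0 < optOn y s.C₀ ∨ I.cost y s.C₀ s.start = 0
  cost_le : I.facCost (s.frozen ∪ s.cur.S) + I.connCost y (Finset.range t) s.cur.σ ≤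
    (1 + √2 + 17 * ε') * optOn y (Finset.range t)

/-- The snapshot before the first arrival. -/
structure Snapshot.IsInitial {F : Type*} (s : Snapshot F) : Prop where
  C_eq : s.C = ∅
  C₀_eq : s.C₀ = ∅
  cur_eq : s.cur.S = ∅
  start_eq : s.start.S = ∅
  frozen_eq : s.frozen = ∅

variable {F : Type*} [DecidableEq F] {I : FLInstance F} {ε' : ℝ} {y : ℕ → Client I} {t : ℕ}
  {s s' : Snapshot F} {S' : Finset F} {i : F} {q : Config F ℕ}

theorem Snapshot.IsInitial.valid (h : s.IsInitial) (hε : 0 < ε') : s.Valid ε' y 0 := by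
  have h0 := optOn_nonneg y (∅ : Finset ℕ)
  have h2 := Real.sqrt_nonneg 2
  refine ⟨?_, ?_, ?_, ?_, ?_, ?_, ?_, ?_, ?_, ?_, ?_, ?_, ?_⟩ <;>
    simp only [Config.Feasible, cost, facCost, connCost, h.C_eq, h.C₀_eq, h.cur_eq, h.start_eq,
      h.frozen_eq, Finset.range_zero, Finset.sum_empty, Finset.empty_sdiff,
      Finset.empty_union]
  · exact subset_rfl
  · exact subset_rfl
  · exact fun h => absurd h (lt_irrefl 0)
  · simp
  · simp
  · simp
  · simp
  · linarith
  · linarith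
  · simp
  · intro k R hR
    rw [Finset.subset_empty.1 hR]
    simpa using mul_nonneg h2 (I.openCost_nonneg k)
  · simp
  · rw [add_zero]
    positivity

section Step

variable (hv : s.Valid ε' y t) (h : Transition ε' y t s s' S' i q)
include hv

theorem Snapshot.Valid.notMem : t ∉ s.C := fun ht => by
  simpa using hv.subset_range ht

theorem Snapshot.Valid.cost_start_update :
    I.cost y s.C₀ ⟨s.start.S, Function.update s.start.σ t i⟩ = I.cost y s.C₀ s.start :=
  congrArg (I.facCost s.start.S + ·) (I.connCost_congr y fun _ hj =>
    Function.update_of_ne (ne_of_mem_of_not_mem (hv.C₀_subset hj) hv.notMem) _ _)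

include h

theorem Snapshot.Valid.exists_run [Nonempty F] (hε : 0 < ε') :
    ∃ N, Run (ε' * optOn y (insert t s.C) / ((1 + √2) * (insert t s.C).card)) y (insert t s.C)
      ⟨S', Function.update s.cur.σ t i⟩ q N :=
  (LocalSearch.exists_run hε.le (fun _ hr => optOn_le y hr (Finset.insert_nonempty _ _))
    (h.connect.feasible hv.cur_feasible) h.settles.1).2

theorem Snapshot.Valid.settled_feasible [Nonempty F] (hε : 0 < ε') :
    q.Feasible (insert t s.C) := by
  obtain ⟨N, hN⟩ := hv.exists_run h hε
  exact hN.feasible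

theorem Snapshot.Valid.settled_σ_eq [Nonempty F] (hε : 0 < ε') {j : ℕ} (hj : j ∉ insert t s.C) :
    q.σ j = s.cur.σ j := by
  obtain ⟨N, hN⟩ := hv.exists_run h hε
  obtain ⟨R, hR, -, hσ⟩ := hN.changed
  rw [hσ j fun hjR => hj (hR hjR)]
  exact Function.update_of_ne (by rintro rfl; exact hj (Finset.mem_insert_self _ _)) _ _

theorem Snapshot.Valid.settled_cost_le [Nonempty F] (hε : 0 < ε') (hε1 : ε' ≤ 1 / 100) :
    I.cost y (insert t s.C) q ≤ (1 + √2) * (1 + 2 * ε') * optOn y (insert t s.C) := by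
  have h2 := Real.sqrt_nonneg 2
  have hcard : (0 : ℝ) < (insert t s.C).card := by
    exact_mod_cast Finset.card_pos.2 (Finset.insert_nonempty t s.C)
  have hq := hv.settled_feasible h hε
  have := le_mul_optOn y (C := insert t s.C) (a := I.cost y (insert t s.C) q) (b := 0)
    (α := (1 + √2) * (1 + 2 * ε')) (by positivity) fun r hr => ?_
  · rwa [zero_add] at this
  have h1 := cost_le_of_not_efficient (threshold_nonneg hε.le y _ _) h.settles.2 hq
    (r := r) fun j _ => hr j
  have h3 : (1 + √2) * (I.cost y (insert t s.C) r +
      threshold I ε' y (insert t s.C) q * (insert t s.C).card) =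
      (1 + √2) * I.cost y (insert t s.C) r + ε' * I.cost y (insert t s.C) q := by
    unfold threshold
    field_simp
  rw [h3] at h1
  have h4 := I.cost_nonneg y (insert t s.C) q
  have h5 := mul_nonneg (by positivity : 0 ≤ (1 + √2)) (I.cost_nonneg y (insert t s.C) r)
  rw [zero_add]
  have h6 : I.cost y (insert t s.C) q * (1 - ε') ≤ (1 + √2) * I.cost y (insert t s.C) r := by
    linarith
  -- The factor 1 + 2ε' removes 1 - ε', since (1 - ε')(1 + 2ε') ≥ 1 for ε' ≤ 1/2.
  have h7 := mul_le_mul_of_nonneg_right h6 (by positivity : 0 ≤ 1 + 2 * ε')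
  have h8 : 0 ≤ I.cost y (insert t s.C) q * (ε' * (1 - 2 * ε')) :=
    mul_nonneg h4 (mul_nonneg hε.le (by linarith))
  nlinarith

theorem Snapshot.Valid.settled_cost_le' [Nonempty F] (hε : 0 < ε') (hε1 : ε' ≤ 1 / 100) :
    I.cost y (insert t s.C) q ≤ 5 / 2 * optOn y (insert t s.C) := by
  refine (hv.settled_cost_le h hε hε1).trans ?_
  refine mul_le_mul_of_nonneg_right ?_ (optOn_nonneg _ _)
  have := one_add_sqrt_two_le
  have := Real.sqrt_nonneg 2
  nlinarith

/-- An opening operation involves only the clients in `R`, so this part of local optimality survives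
the removal of other clients, and the threshold per client only grows when `C'` is smaller. It is
all that the recourse analysis uses about the state met by the next arrival. -/
theorem Snapshot.Valid.settled_open_inequality [Nonempty F] (k : F) {a : ℝ}
    {C' R : Finset ℕ} (ha : I.cost y (insert t s.C) q ≤ 3 * a) (hε1 : ε' ≤ 1 / 100)
    (hC' : C' ⊆ insert t s.C) (hR : R ⊆ C') :
    ∑ j ∈ R, (y j).dist (q.σ j) ≤
      √2 * I.openCost k + ∑ j ∈ R, (y j).dist k + a / C'.card * R.card := by
  rcases R.eq_empty_or_nonempty with rfl | hne
  · simpa using mul_nonneg (Real.sqrt_nonneg 2) (I.openCost_nonneg k)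
  refine (LocalSearch.open_inequality h.settles.2 k (hR.trans hC')).trans ?_
  gcongr
  have h1 : (0 : ℝ) < C'.card := by exact_mod_cast Finset.card_pos.2 (hne.mono hR)
  have h2 : (C'.card : ℝ) ≤ (insert t s.C).card := by exact_mod_cast Finset.card_le_card hC'
  have h3 := I.cost_nonneg y (insert t s.C) q
  have h4 := Real.sqrt_nonneg 2
  have ha0 : 0 ≤ a := by linarith
  unfold threshold
  rw [div_le_div_iff₀ (by positivity) h1]
  have h5 : ε' * I.cost y (insert t s.C) q ≤ a := by nlinarith
  have h6 : (C'.card : ℝ) ≤ (1 + √2) * (insert t s.C).card := by nlinarith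
  exact mul_le_mul h5 h6 h1.le ha0

theorem Snapshot.Valid.continue [Nonempty F] (hε : 0 < ε') (hε1 : ε' ≤ 1 / 100)
    (hle : I.cost y (insert t s.C) q ≤ I.cost y s.C₀ s.start / ε') :
    (s.continue t i q).Valid ε' y (t + 1) := by
  have ht := hv.notMem
  have hcost := hv.settled_cost_le' h hε hε1
  have hopt := optOn_nonneg y (insert t s.C)
  have hstart : I.cost y (s.continue t i q).C₀ (s.continue t i q).start = I.cost y s.C₀ s.start :=
    hv.cost_start_update
  have hsub : insert t s.C ⊆ Finset.range (t + 1) := by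
    rw [Finset.range_add_one]
    exact Finset.insert_subset_insert _ hv.subset_range
  have hsd : Finset.range (t + 1) \ insert t s.C = Finset.range t \ s.C := by
    rw [Finset.range_add_one, Finset.insert_sdiff_insert, Finset.sdiff_insert_of_notMem]
    simp
  have hσ : ∀ j ∈ Finset.range t \ s.C, q.σ j = s.cur.σ j := fun j hj => by
    rw [← hsd] at hj
    exact hv.settled_σ_eq h hε (Finset.mem_sdiff.1 hj).2
  have hfrozen : I.facCost s.frozen +
      I.connCost y (Finset.range (t + 1) \ insert t s.C) q.σ ≤ 4 * ε' * I.cost y s.C₀ s.start := by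
    rw [hsd, I.connCost_congr y hσ]
    exact hv.frozen_le
  refine
    { subset_range := hsub
      C₀_subset := hv.C₀_subset.trans (Finset.subset_insert _ _)
      nonempty := fun _ => Finset.insert_nonempty _ _
      cur_feasible := hv.settled_feasible h hε
      start_feasible := fun j hj => ?_
      mem_frozen := fun j hj => ?_
      frozen_le := hstart.symm ▸ hfrozen
      start_le := hstart.symm ▸ hv.start_le
      cur_le := hcost.trans (by unfold Snapshot.continue; dsimp only; linarith)
      cur_le_start := hstart.symm ▸ hle
      open_inequality := fun k R hR => hv.settled_open_inequality h k
        (a := optOn y (insert t s.C)) (by linarith) hε1 subset_rfl hR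
      optOn_pos := hstart.symm ▸ hv.optOn_pos
      cost_le := ?_ }
  · have := hv.start_feasible j hj
    unfold Snapshot.continue
    dsimp only
    rwa [Function.update_of_ne (ne_of_mem_of_not_mem (hv.C₀_subset hj) ht)]
  · have hj' : j ∈ Finset.range (t + 1) \ insert t s.C := hj
    rw [hsd] at hj'
    have := hv.mem_frozen j hj'
    rwa [← hσ j hj'] at this
  -- The 17 is 12 + 5: frozen costs are at most 4ε' times the starting cost, itself at most 3 times
  -- the optimum, and (1 + √2)·2ε' ≤ 5ε'.
  · have h1 := I.facCost_union_le s.frozen q.S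
    have h2 := I.connCost_sdiff_add y hsub q.σ
    have h3 := hv.settled_cost_le h hε hε1
    have h4 := optOn_mono y hsub
    have h5 := optOn_mono y (hv.C₀_subset.trans ((Finset.subset_insert t _).trans hsub))
    have h6 := hv.start_le
    have h7 := one_add_sqrt_two_le
    have h8 : I.facCost q.S + I.connCost y (insert t s.C) q.σ = I.cost y (insert t s.C) q := rfl
    have h9 := Real.sqrt_nonneg 2
    have h10 := mul_le_mul_of_nonneg_left h4 (by positivity : 0 ≤ (1 + √2) * (1 + 2 * ε'))
    have h11 := mul_le_mul_of_nonneg_left (h6.trans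
      (mul_le_mul_of_nonneg_left h5 zero_le_three)) (by positivity : 0 ≤ 4 * ε')
    have h12 : 0 ≤ (5 - 2 * (1 + √2)) * ε' * optOn y (Finset.range (t + 1)) :=
      mul_nonneg (mul_nonneg (by linarith) hε.le) (hopt.trans h4)
    unfold Snapshot.continue
    dsimp only
    nlinarith

/-- The solution being frozen costs less than ε' times the current one. Hence the optimum of the
remaining clients is still comparable to the current cost, and old and new frozen costs together
stay O(ε') of the cost that starts the new stage. -/
theorem Snapshot.Valid.freeze [Nonempty F] (hε : 0 < ε') (hε1 : ε' ≤ 1 / 100)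
    (hlt : I.cost y s.C₀ s.start / ε' < I.cost y (insert t s.C) q) :
    (s.freeze t i q).Valid ε' y (t + 1) := by
  have ht := hv.notMem
  have hC₀C : s.C₀ ⊆ insert t s.C := hv.C₀_subset.trans (Finset.subset_insert t _)
  have hcost := hv.settled_cost_le' h hε hε1
  have hopt := optOn_nonneg y (insert t s.C)
  have hstart := hv.cost_start_update (i := i)
  have hstart0 := I.cost_nonneg y s.C₀ s.start
  have hsub : insert t s.C ⊆ Finset.range (t + 1) := by
    rw [Finset.range_add_one]
    exact Finset.insert_subset_insert _ hv.subset_range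
  set C' := insert t s.C \ s.C₀ with hC'
  have hC'sub : C' ⊆ insert t s.C := Finset.sdiff_subset
  have hne : C'.Nonempty := ⟨t, Finset.mem_sdiff.2 ⟨Finset.mem_insert_self _ _,
    fun hh => ht (hv.C₀_subset hh)⟩⟩
  have hlt' : I.cost y s.C₀ s.start < ε' * I.cost y (insert t s.C) q := by
    rwa [div_lt_iff₀' hε] at hlt
  have hsplit := optOn_le_add y hv.start_feasible hC₀C
  rw [← hC'] at hsplit
  -- The cost is at most 5/2 · (ε' · cost + `optOn y C'`); for ε' ≤ 1/100, absorbing the first term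
  -- raises 5/2 to less than 3.
  have hcost3 : I.cost y (insert t s.C) q ≤ 3 * optOn y C' := by
    have := I.cost_nonneg y (insert t s.C) q
    nlinarith
  have hqσ : ∀ j ∈ C', (s.freezeConfig t i q).σ j = q.σ j := fun j hj =>
    if_neg (Finset.mem_sdiff.1 hj).2
  have hC₀σ : ∀ j ∈ s.C₀, (s.freezeConfig t i q).σ j = s.start.σ j := fun j hj =>
    (if_pos hj).trans
      (Function.update_of_ne (ne_of_mem_of_not_mem (hv.C₀_subset hj) ht) _ _)
  have holdσ : ∀ j ∈ Finset.range t \ s.C, (s.freezeConfig t i q).σ j = s.cur.σ j := fun j hj => by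
    obtain ⟨hj1, hj2⟩ := Finset.mem_sdiff.1 hj
    refine (if_neg fun hh => hj2 (hv.C₀_subset hh)).trans (hv.settled_σ_eq h hε fun hh => ?_)
    exact hj2 (Finset.mem_of_mem_insert_of_ne hh (Finset.mem_range.1 hj1).ne)
  have hsd : Finset.range (t + 1) \ C' = (Finset.range t \ s.C) ∪ s.C₀ := by
    ext j
    have h1 := @hv.C₀_subset j
    have h2 := @hv.subset_range j
    simp only [hC', Finset.mem_sdiff, Finset.mem_union, Finset.mem_range, Finset.mem_insert] at *
    grind
  have hdisj : Disjoint (Finset.range t \ s.C) s.C₀ :=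
    Finset.disjoint_left.2 fun j hj hj' => (Finset.mem_sdiff.1 hj).2 (hv.C₀_subset hj')
  have hcur : I.cost y C' (s.freezeConfig t i q) ≤ I.cost y (insert t s.C) q := by
    refine le_trans (le_of_eq ?_) (I.cost_mono y hC'sub q)
    exact congrArg (I.facCost q.S + ·) (I.connCost_congr y hqσ)
  have hfeas : (s.freezeConfig t i q).Feasible C' := fun j hj => by
    rw [hqσ j hj]
    exact hv.settled_feasible h hε j (hC'sub hj)
  have hconn : I.connCost y (Finset.range (t + 1) \ C') (s.freezeConfig t i q).σ =
      I.connCost y (Finset.range t \ s.C) s.cur.σ + I.connCost y s.C₀ s.start.σ := by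
    rw [hsd, ← I.connCost_congr y holdσ, ← I.connCost_congr y hC₀σ]
    exact Finset.sum_union hdisj
  have hfrozen : I.facCost (s.frozen ∪ s.start.S) +
      I.connCost y (Finset.range (t + 1) \ C') (s.freezeConfig t i q).σ ≤
      (1 + 4 * ε') * I.cost y s.C₀ s.start := by
    rw [hconn]
    have h1 := I.facCost_union_le s.frozen s.start.S
    have h2 := hv.frozen_le
    have h3 : I.facCost s.start.S + I.connCost y s.C₀ s.start.σ = I.cost y s.C₀ s.start := rfl
    linarith
  have hoptle := optOn_le y hfeas hne
  refine
    { subset_range := hC'sub.trans hsub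
      C₀_subset := subset_rfl
      nonempty := fun _ => hne
      cur_feasible := hfeas
      start_feasible := hfeas
      mem_frozen := fun j hj => ?_
      frozen_le := hfrozen.trans ?_
      start_le := hcur.trans hcost3
      cur_le := hcur.trans hcost3
      cur_le_start := ?_
      open_inequality := fun k R hR => ?_
      optOn_pos := Or.inl ?_
      cost_le := ?_ }
  · have hj' : j ∈ Finset.range (t + 1) \ C' := hj
    rw [hsd, Finset.mem_union] at hj'
    unfold Snapshot.freeze
    dsimp only
    rcases hj' with hj' | hj'
    · rw [holdσ j hj']
      exact Finset.mem_union_left _ (hv.mem_frozen j hj')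
    · rw [hC₀σ j hj']
      exact Finset.mem_union_right _ (hv.start_feasible j hj')
  · unfold Snapshot.freeze
    dsimp only
    have h1 : I.cost y s.C₀ s.start ≤ 3 * ε' * I.cost y C' (s.freezeConfig t i q) := by
      nlinarith
    -- The constant 4 reproduces itself: (1 + 4ε')·3ε' ≤ 4ε' as soon as 12ε' ≤ 1.
    have h2 := mul_le_mul_of_nonneg_left h1 (by positivity : 0 ≤ 1 + 4 * ε')
    have h3 := I.cost_nonneg y C' (s.freezeConfig t i q)
    have h4 : 0 ≤ ε' * (1 - 12 * ε') * I.cost y C' (s.freezeConfig t i q) :=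
      mul_nonneg (mul_nonneg hε.le (by linarith)) h3
    nlinarith
  · exact le_div_self (I.cost_nonneg _ _ _) hε (by linarith)
  · have h1 := hv.settled_open_inequality h k hcost3 hε1 hC'sub hR
    rw [Finset.sum_congr rfl fun j hj => by rw [← hqσ j (hR hj)]] at h1
    exact h1
  · change 0 < optOn y C'
    have h1 : 0 ≤ I.cost y s.C₀ s.start / ε' := by positivity
    linarith
  · have h1 := I.facCost_union_le (s.frozen ∪ s.start.S) q.S
    have h2 := I.connCost_sdiff_add y (hC'sub.trans hsub) (s.freezeConfig t i q).σ
    have h3 := hv.settled_cost_le h hε hε1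
    have h4 := optOn_mono y hsub
    have h7 := one_add_sqrt_two_le
    have h8 : I.facCost q.S + I.connCost y C' (s.freezeConfig t i q).σ =
      I.cost y C' (s.freezeConfig t i q) := rfl
    have h9 := Real.sqrt_nonneg 2
    have h10 := mul_le_mul_of_nonneg_left h4 (by positivity : 0 ≤ (1 + √2) * (1 + 2 * ε'))
    have h11 : 0 ≤ (5 - 2 * (1 + √2)) * ε' * optOn y (Finset.range (t + 1)) :=
      mul_nonneg (mul_nonneg (by linarith) hε.le) (hopt.trans h4)
    have h12 : (1 + 4 * ε') * I.cost y s.C₀ s.start ≤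
        5 * ε' * optOn y (Finset.range (t + 1)) := by nlinarith
    have h13 : 0 ≤ ε' * optOn y (Finset.range (t + 1)) := mul_nonneg hε.le (hopt.trans h4)
    have h14 : I.facCost ((s.freeze t i q).frozen ∪ (s.freeze t i q).cur.S) =
      I.facCost (s.frozen ∪ s.start.S ∪ q.S) := rfl
    have h15 : (s.freeze t i q).cur = s.freezeConfig t i q := rfl
    rw [h14, h15]
    linarith

theorem Snapshot.Valid.next [Nonempty F] (hε : 0 < ε') (hε1 : ε' ≤ 1 / 100) :
    s'.Valid ε' y (t + 1) := by
  rcases h.next with ⟨hle, rfl⟩ | ⟨hlt, rfl⟩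
  · rw [hv.cost_start_update] at hle
    exact hv.continue h hε hε1 hle
  · rw [hv.cost_start_update] at hlt
    exact hv.freeze h hε hε1 hlt

end Step

end LocalSearch

/-! ### Logarithmic and harmonic sums -/

/-- If `b` has partial sums at most `B a` for a nondecreasing `a ≥ α > 0`, then the partial sums of
`b / a` grow only logarithmically in `a`. -/
theorem sum_div_le_of_sum_le {a b : ℕ → ℝ} {α B : ℝ} {m n : ℕ} (hα : 0 < α) (hmn : m ≤ n)
    (hαa : ∀ u, m ≤ u → u ≤ n → α ≤ a u) (ha : ∀ u, m ≤ u → u < n → a u ≤ a (u + 1))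
    (hb : ∀ u, m ≤ u → u ≤ n → 0 ≤ b u)
    (hB : ∀ u, m ≤ u → u ≤ n → ∑ v ∈ Finset.Ico m (u + 1), b v ≤ B * a u) :
    ∑ u ∈ Finset.Ico m (n + 1), b u / a u ≤ B * (1 + Real.log (a n / α)) := by
  have hB0 : 0 ≤ B := by
    have h1 := hB m le_rfl hmn
    have h2 := hb m le_rfl hmn
    have h3 := hαa m le_rfl hmn
    rw [Nat.Ico_succ_singleton, Finset.sum_singleton] at h1
    by_contra! hneg
    nlinarith
  -- The induction keeps the ratio of the partial sum to `a k`. When `a` grows, this ratio drops by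
  -- at most `B * (1 - a k / a (k + 1))`, hence by at most `B` times the increment of `log a`, and
  -- the logarithms telescope.
  have key : ∀ k, m ≤ k → k ≤ n → ∑ u ∈ Finset.Ico m (k + 1), b u / a u ≤
      (∑ u ∈ Finset.Ico m (k + 1), b u) / a k + B * Real.log (a k / α) := by
    intro k hk
    induction k, hk using Nat.le_induction with
    | base =>
      intro _
      rw [Nat.Ico_succ_singleton, Finset.sum_singleton, Finset.sum_singleton]
      exact le_add_of_nonneg_right (mul_nonneg hB0
        (Real.log_nonneg ((one_le_div hα).2 (hαa m le_rfl hmn))))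
    | succ k hk ih =>
      intro hkn
      have hk0 : 0 < a k := hα.trans_le (hαa k hk (by omega))
      have hk1 : 0 < a (k + 1) := hα.trans_le (hαa (k + 1) (by omega) hkn)
      have hmono := ha k hk (by omega)
      have hW := hB k hk (by omega)
      have ih := ih (by omega)
      rw [Finset.sum_Ico_succ_top (by omega), Finset.sum_Ico_succ_top (b := k + 1) (by omega)]
      set W := ∑ u ∈ Finset.Ico m (k + 1), b u
      have hlog : Real.log (a (k + 1) / α) = Real.log (a k / α) + Real.log (a (k + 1) / a k) := by
        rw [← Real.log_mul (by positivity) (by positivity)]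
        congr 1
        field_simp
      have hlog2 : 1 - a k / a (k + 1) ≤ Real.log (a (k + 1) / a k) := by
        have := Real.one_sub_inv_le_log_of_pos (x := a (k + 1) / a k) (by positivity)
        rwa [inv_div] at this
      have h1 : W / a k - W / a (k + 1) ≤ B * (1 - a k / a (k + 1)) := by
        have e : W / a k - W / a (k + 1) = W / a k * (1 - a k / a (k + 1)) := by field_simp
        rw [e]
        refine mul_le_mul_of_nonneg_right ((div_le_iff₀ hk0).2 hW) ?_
        rw [sub_nonneg, div_le_one hk1]
        exact hmono
      have h2 := mul_le_mul_of_nonneg_left hlog2 hB0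
      rw [hlog, add_div, mul_add]
      linarith
  have h := key n hmn le_rfl
  have hn0 : 0 < a n := hα.trans_le (hαa n hmn le_rfl)
  have h2 := (div_le_iff₀ hn0).2 (hB n hmn le_rfl)
  linarith

theorem sum_comp_le_sum_range {A : Finset ℕ} {c : ℕ → ℕ} {g : ℕ → ℝ} {n : ℕ}
    (hc : Set.InjOn c A) (hcn : ∀ u ∈ A, c u < n) (hg : ∀ k, 0 ≤ g k) :
    ∑ u ∈ A, g (c u) ≤ ∑ k ∈ Finset.range n, g k := by
  rw [← Finset.sum_image hc]
  refine Finset.sum_le_sum_of_subset_of_nonneg (fun k hk => ?_) fun k _ _ => hg k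
  obtain ⟨u, hu, rfl⟩ := Finset.mem_image.1 hk
  exact Finset.mem_range.2 (hcn u hu)

theorem sum_inv_range (n : ℕ) :
    ∑ k ∈ Finset.range (n + 1), (k : ℝ)⁻¹ = (harmonic n : ℝ) := by
  rw [Finset.sum_range_succ', harmonic]
  push_cast
  simp

namespace LocalSearch

open FLInstance

/-! ### Cost increase by arrivals in a stage -/

section Star

variable {F : Type*} [DecidableEq F] {I : FLInstance F} {y : ℕ → Client I}

/-- The total increase over a stage. At time `u ∈ [m, T]`, the clients in `C₀ ∪ [m, u)` have arrived
and `e u j` is the connection cost of client `j`. -/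
theorem sum_increase_le {C₀ : Finset ℕ} {m T : ℕ} (hC₀ : C₀ ⊆ Finset.range m) {Δ φ : ℕ → ℝ}
    {e : ℕ → ℕ → ℝ} (hφ : ∀ u, 0 ≤ φ u)
    (h_new : ∀ u ∈ Finset.Ico m (T + 1), ∀ k, Δ u ≤ √2 * (I.openCost k + (y u).dist k))
    (h_via : ∀ u ∈ Finset.Ico m (T + 1), ∀ k, ∀ j ∈ C₀ ∪ Finset.Ico m u,
      Δ u ≤ √2 * ((y u).dist k + (y j).dist k + e u j))
    (h_loc : ∀ u ∈ Finset.Ico m (T + 1), ∀ k, ∀ R ⊆ C₀ ∪ Finset.Ico m u,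
      ∑ j ∈ R, e u j ≤ √2 * I.openCost k + ∑ j ∈ R, (y j).dist k + φ u * R.card)
    {r : Config F ℕ} (hr : ∀ j, r.σ j ∈ r.S) :
    ∑ u ∈ Finset.Ico m (T + 1), Δ u ≤
      √2 * ((1 + 2 * harmonic T) * I.cost y (C₀ ∪ Finset.Ico m (T + 1)) r +
        ∑ u ∈ Finset.Ico m (T + 1), φ u) := by
  set D : ℕ → Finset ℕ := fun u => C₀ ∪ Finset.Ico m u with hD
  have hDmono : ∀ u v, u ≤ v → D u ⊆ D v := fun u v huv =>
    Finset.union_subset_union_right (Finset.Ico_subset_Ico_right huv)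
  set star : ℕ → F → Finset ℕ := fun u k => (D u).filter fun j => r.σ j = k with hstar
  set w : F → ℝ := fun k => √2 * I.openCost k + 2 * ∑ j ∈ star (T + 1) k, (y j).dist k with hw
  have hw0 : ∀ k, 0 ≤ w k := fun k => add_nonneg
    (mul_nonneg (Real.sqrt_nonneg 2) (I.openCost_nonneg k))
    (mul_nonneg zero_le_two (Finset.sum_nonneg fun j _ => (y j).dist_nonneg k))
  -- `g k n` is the charge to `k` for a client that finds `n` earlier ones in its star: the opening
  -- cost if it is the first, else a share of `w k`. As `0⁻¹ = 0`, the two cases do not overlap.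
  set g : F → ℕ → ℝ := fun k n => (if n = 0 then I.openCost k else 0) + w k * (n : ℝ)⁻¹ with hg
  have hg0 : ∀ k n, 0 ≤ g k n := fun k n => by
    have := hw0 k
    have := I.openCost_nonneg k
    simp only [hg]
    split_ifs <;> positivity
  have hstep : ∀ u ∈ Finset.Ico m (T + 1),
      Δ u ≤ √2 * ((y u).dist (r.σ u) + g (r.σ u) (star u (r.σ u)).card + φ u) := by
    intro u hu
    rcases (star u (r.σ u)).eq_empty_or_nonempty with hR | hR
    · refine (h_new u hu (r.σ u)).trans ?_
      refine mul_le_mul_of_nonneg_left ?_ (Real.sqrt_nonneg 2)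
      rw [hR]
      simp only [hg, Finset.card_empty, if_true, Nat.cast_zero, inv_zero, mul_zero]
      linarith [hφ u]
    · set R := star u (r.σ u) with hRdef
      have hRD : R ⊆ D u := Finset.filter_subset _ _
      have hcard : (0 : ℝ) < R.card := by exact_mod_cast Finset.card_pos.2 hR
      -- The bound via an earlier client is averaged over all earlier clients of the star; `h_loc`
      -- then replaces their connection costs by costs of `r`.
      have h1 := Finset.card_nsmul_le_sum R
        (fun j => √2 * ((y u).dist (r.σ u) + (y j).dist (r.σ u) + e u j)) (Δ u)
        fun j hj => h_via u hu _ j (hRD hj)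
      rw [nsmul_eq_mul, ← Finset.mul_sum, Finset.sum_add_distrib, Finset.sum_add_distrib,
        Finset.sum_const, nsmul_eq_mul] at h1
      have h2 := h_loc u hu (r.σ u) R hRD
      have h3 : ∑ j ∈ R, (y j).dist (r.σ u) ≤ ∑ j ∈ star (T + 1) (r.σ u), (y j).dist (r.σ u) :=
        Finset.sum_le_sum_of_subset_of_nonneg
          (Finset.filter_subset_filter _ (hDmono _ _ (Finset.mem_Ico.1 hu).2.le))
          fun j _ _ => (y j).dist_nonneg _
      have h4 : R.card * Δ u ≤
          √2 * (R.card * (y u).dist (r.σ u) + w (r.σ u) + φ u * R.card) := by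
        refine h1.trans (mul_le_mul_of_nonneg_left ?_ (Real.sqrt_nonneg 2))
        simp only [hw]
        linarith
      have h5 : g (r.σ u) R.card = w (r.σ u) * (R.card : ℝ)⁻¹ := by
        simp only [hg]
        rw [if_neg (Finset.card_pos.2 hR).ne', zero_add]
      rw [h5]
      refine le_of_mul_le_mul_left (h4.trans (le_of_eq ?_)) hcard
      field_simp
  refine (Finset.sum_le_sum hstep).trans ?_
  rw [← Finset.mul_sum, Finset.sum_add_distrib]
  refine mul_le_mul_of_nonneg_left (add_le_add_left ?_ _) (Real.sqrt_nonneg 2)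
  rw [Finset.sum_add_distrib]
  have hconn1 : ∑ u ∈ Finset.Ico m (T + 1), (y u).dist (r.σ u) ≤ I.connCost y (D (T + 1)) r.σ :=
    Finset.sum_le_sum_of_subset_of_nonneg Finset.subset_union_right fun j _ _ =>
      (y j).dist_nonneg _
  have hgsum : ∀ k, ∑ n ∈ Finset.range (T + 1), g k n = I.openCost k + w k * harmonic T := by
    intro k
    simp only [hg]
    rw [Finset.sum_add_distrib, ← Finset.mul_sum, sum_inv_range]
    simp
  have hstars : ∑ u ∈ Finset.Ico m (T + 1), g (r.σ u) (star u (r.σ u)).card ≤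
      ∑ k ∈ r.S, (I.openCost k + w k * harmonic T) := by
    rw [← Finset.sum_fiberwise_of_maps_to fun u _ => hr u]
    refine Finset.sum_le_sum fun k _ => ?_
    rw [← hgsum k]
    rw [Finset.sum_congr rfl fun u hu => by rw [(Finset.mem_filter.1 hu).2]]
    refine sum_comp_le_sum_range (c := fun u => (star u k).card) ?_ ?_ (hg0 k)
    -- Each arrival in a star enlarges it, so the counts seen by its members are distinct and each
    -- value of `g k` is charged at most once.
    · have hlt : ∀ u ∈ (Finset.Ico m (T + 1)).filter (fun j => r.σ j = k), ∀ v, u < v →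
          (star u k).card < (star v k).card := by
        intro u hu v huv
        obtain ⟨hu1, hu2⟩ := Finset.mem_filter.1 hu
        have hum := (Finset.mem_Ico.1 hu1).1
        refine Finset.card_lt_card (Finset.ssubset_iff_subset_ne.2
          ⟨Finset.filter_subset_filter _ (hDmono _ _ huv.le), fun heq => ?_⟩)
        have hmem : u ∈ star v k := Finset.mem_filter.2
          ⟨Finset.mem_union_right _ (Finset.mem_Ico.2 ⟨hum, huv⟩), hu2⟩
        rw [← heq] at hmem
        rcases Finset.mem_union.1 (Finset.mem_filter.1 hmem).1 with h | h
        · have := Finset.mem_range.1 (hC₀ h)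
          omega
        · exact lt_irrefl u (Finset.mem_Ico.1 h).2
      intro u hu v hv huv
      rcases lt_trichotomy u v with h | h | h
      · exact absurd huv (hlt u hu v h).ne
      · exact h
      · exact absurd huv (hlt v hv u h).ne'
    · intro u hu
      obtain ⟨hu1, -⟩ := Finset.mem_filter.1 hu
      obtain ⟨hum, huT⟩ := Finset.mem_Ico.1 hu1
      have hsub : star u k ⊆ Finset.range u := by
        refine (Finset.filter_subset _ _).trans (Finset.union_subset ?_ ?_)
        · exact hC₀.trans (Finset.range_subset_range.2 hum)
        · intro j hj
          exact Finset.mem_range.2 (Finset.mem_Ico.1 hj).2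
      have := Finset.card_le_card hsub
      rw [Finset.card_range] at this
      exact this.trans_lt huT
  have hwsum : ∑ k ∈ r.S, w k = √2 * I.facCost r.S + 2 * I.connCost y (D (T + 1)) r.σ := by
    simp only [hw]
    rw [Finset.sum_add_distrib, ← Finset.mul_sum, ← Finset.mul_sum]
    congr 2
    unfold connCost
    rw [← Finset.sum_fiberwise_of_maps_to fun u _ => hr u]
    exact Finset.sum_congr rfl fun k _ => Finset.sum_congr rfl fun j hj => by
      rw [(Finset.mem_filter.1 hj).2]
  have hsplit : ∑ k ∈ r.S, (I.openCost k + w k * harmonic T) = I.facCost r.S +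
      (√2 * I.facCost r.S + 2 * I.connCost y (D (T + 1)) r.σ) * harmonic T := by
    rw [Finset.sum_add_distrib, ← Finset.sum_mul, hwsum]
    rfl
  rw [hsplit] at hstars
  have hH : (0 : ℝ) ≤ harmonic T := by
    rw [← sum_inv_range]
    positivity
  have hf0 := I.facCost_nonneg r.S
  have hs2 : √2 ≤ 2 := by have := one_add_sqrt_two_le; linarith
  have h6 : √2 * I.facCost r.S * harmonic T ≤ 2 * I.facCost r.S * harmonic T := by gcongr
  unfold cost
  nlinarith

end Star

/-! ### Number of reconnections along a run -/

/-- A run of the algorithm on a sequence of clients, in terms of snapshots. -/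
structure Trace {F : Type*} [DecidableEq F] {I : FLInstance F} (ε' : ℝ) (y : ℕ → Client I) where
  s : ℕ → Snapshot F
  S' : ℕ → Finset F
  i : ℕ → F
  q : ℕ → Config F ℕ
  init : (s 0).IsInitial
  step : ∀ t, Transition ε' y t (s t) (s (t + 1)) (S' t) (i t) (q t)
  pos : 0 < ε'
  le : ε' ≤ 1 / 100

namespace Trace

variable {F : Type*} [DecidableEq F] [Nonempty F] {I : FLInstance F} {ε' : ℝ} {y : ℕ → Client I}
  (T : Trace ε' y)

theorem valid (t : ℕ) : (T.s t).Valid ε' y t := by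
  induction t with
  | zero => exact T.init.valid T.pos
  | succ t ih => exact ih.next (T.step t) T.pos T.le

/-- The stage ends with the arrival of client `t`. -/
def Ends (t : ℕ) : Prop :=
  I.cost y (T.s t).C₀ (T.s t).start / ε' < I.cost y (insert t (T.s t).C) (T.q t)

theorem next_of_ends {t : ℕ} (h : T.Ends t) :
    T.s (t + 1) = (T.s t).freeze t (T.i t) (T.q t) := by
  rcases (T.step t).next with ⟨hle, -⟩ | ⟨-, hs⟩
  · rw [(T.valid t).cost_start_update] at hle
    exact absurd h (not_lt.2 hle)
  · exact hs

theorem next_of_not_ends {t : ℕ} (h : ¬ T.Ends t) :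
    T.s (t + 1) = (T.s t).continue t (T.i t) (T.q t) := by
  rcases (T.step t).next with ⟨-, hs⟩ | ⟨hlt, -⟩
  · exact hs
  · rw [(T.valid t).cost_start_update] at hlt
    exact absurd hlt h

open Classical in
/-- The time at which the current stage has begun. -/
noncomputable def stageStart : ℕ → ℕ
  | 0 => 0
  | t + 1 => if T.Ends t then t + 1 else stageStart t

theorem stageStart_of_ends {t : ℕ} (h : T.Ends t) : T.stageStart (t + 1) = t + 1 := if_pos h

theorem stageStart_of_not_ends {t : ℕ} (h : ¬ T.Ends t) :
    T.stageStart (t + 1) = T.stageStart t := if_neg h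

theorem stageStart_le (t : ℕ) : T.stageStart t ≤ t := by
  induction t with
  | zero => exact le_rfl
  | succ t ih =>
    by_cases h : T.Ends t
    · exact (T.stageStart_of_ends h).le
    · exact (T.stageStart_of_not_ends h).le.trans (ih.trans (Nat.le_succ t))

theorem stage_const {t u : ℕ} (h1 : T.stageStart t ≤ u) (h2 : u ≤ t) :
    T.stageStart u = T.stageStart t ∧ (T.s u).C₀ = (T.s t).C₀ ∧
      I.cost y (T.s u).C₀ (T.s u).start = I.cost y (T.s t).C₀ (T.s t).start := by
  induction t with
  | zero =>
    obtain rfl : u = 0 := by omega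
    exact ⟨rfl, rfl, rfl⟩
  | succ t ih =>
    rcases h2.eq_or_lt with rfl | h2
    · exact ⟨rfl, rfl, rfl⟩
    by_cases h : T.Ends t
    · rw [T.stageStart_of_ends h] at h1
      omega
    · rw [T.stageStart_of_not_ends h] at h1 ⊢
      rw [T.next_of_not_ends h]
      obtain ⟨e1, e2, e3⟩ := ih h1 (by omega)
      exact ⟨e1, e2, e3.trans (T.valid t).cost_start_update.symm⟩

theorem not_ends {t u : ℕ} (h1 : T.stageStart t ≤ u) (h2 : u < t) : ¬ T.Ends u := fun h => by
  have h3 := (T.stage_const (u := u + 1) (by omega) h2).1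
  rw [T.stageStart_of_ends h] at h3
  omega

theorem C_eq (t : ℕ) : (T.s t).C = (T.s t).C₀ ∪ Finset.Ico (T.stageStart t) t := by
  induction t with
  | zero => rw [T.init.C_eq, T.init.C₀_eq]; rfl
  | succ t ih =>
    by_cases h : T.Ends t
    · rw [T.stageStart_of_ends h, T.next_of_ends h, Finset.Ico_self, Finset.union_empty]
      rfl
    · rw [T.stageStart_of_not_ends h, T.next_of_not_ends h]
      unfold Snapshot.continue
      dsimp only
      rw [ih, ← Finset.union_insert, Finset.insert_Ico_right_eq_Ico_add_one (T.stageStart_le t)]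

theorem C_eq_of_le {t u : ℕ} (h1 : T.stageStart t ≤ u) (h2 : u ≤ t) :
    (T.s u).C = (T.s t).C₀ ∪ Finset.Ico (T.stageStart t) u := by
  obtain ⟨e1, e2, -⟩ := T.stage_const h1 h2
  rw [T.C_eq u, e1, e2]

theorem insert_C_eq {t u : ℕ} (h1 : T.stageStart t ≤ u) (h2 : u ≤ t) :
    insert u (T.s u).C = (T.s t).C₀ ∪ Finset.Ico (T.stageStart t) (u + 1) := by
  rw [T.C_eq_of_le h1 h2, ← Finset.union_insert, Finset.insert_Ico_right_eq_Ico_add_one h1]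

theorem C₀_subset_range (t : ℕ) : (T.s t).C₀ ⊆ Finset.range (T.stageStart t) := by
  obtain ⟨-, e2, -⟩ := T.stage_const le_rfl (T.stageStart_le t)
  rw [← e2]
  exact (T.valid _).C₀_subset.trans (T.valid _).subset_range

theorem card_C_of_le {t u : ℕ} (h1 : T.stageStart t ≤ u) (h2 : u ≤ t) :
    (T.s u).C.card = (T.s t).C₀.card + (u - T.stageStart t) := by
  rw [T.C_eq_of_le h1 h2, Finset.card_union_of_disjoint, Nat.card_Ico]
  refine Finset.disjoint_left.2 fun j hj hj' => ?_
  have h3 := Finset.mem_range.1 (T.C₀_subset_range t hj)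
  have h4 := (Finset.mem_Ico.1 hj').1
  omega

/-- The optimum for the current clients after the arrival of client `t`. -/
noncomputable def a (t : ℕ) : ℝ := optOn y (insert t (T.s t).C)

/-- The solution after the arrival of client `t`, before local search. -/
def arrival (t : ℕ) : Config F ℕ := ⟨T.S' t, Function.update (T.s t).cur.σ t (T.i t)⟩

/-- The decrease of the scaled cost by local search after the arrival of client `t`. -/
noncomputable def b (t : ℕ) : ℝ :=
  I.scaledCost y (insert t (T.s t).C) (T.arrival t) -
    I.scaledCost y (insert t (T.s t).C) (T.q t)

/-- The increase of the scaled cost by the arrival of client `t`. -/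
noncomputable def Δ (t : ℕ) : ℝ := increase (y t) (T.s t).cur.S (T.S' t) (T.i t)

theorem exists_run (t : ℕ) : ∃ N, Run (ε' * T.a t / ((1 + √2) * (insert t (T.s t).C).card)) y
    (insert t (T.s t).C) (T.arrival t) (T.q t) N :=
  (T.valid t).exists_run (T.step t) T.pos

/-- The number of reconnections made by local search after the arrival of client `t`. -/
noncomputable def N (t : ℕ) : ℕ := (T.exists_run t).choose

theorem run (t : ℕ) : Run (ε' * T.a t / ((1 + √2) * (insert t (T.s t).C).card)) y
    (insert t (T.s t).C) (T.arrival t) (T.q t) (T.N t) :=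
  (T.exists_run t).choose_spec

theorem a_nonneg (t : ℕ) : 0 ≤ T.a t := optOn_nonneg _ _

theorem b_nonneg (t : ℕ) : 0 ≤ T.b t := by
  refine le_trans ?_ (T.run t).mul_le
  have := T.pos
  have := T.a_nonneg t
  positivity

theorem b_eq (t : ℕ) : T.b t = I.scaledCost y (T.s t).C (T.s t).cur + T.Δ t -
    I.scaledCost y (insert t (T.s t).C) (T.q t) := by
  unfold b arrival Δ
  rw [scaledCost_arrival (T.valid t).notMem]

/-- Within a stage the scaled cost changes only by arrivals and local search, so its changes
telescope. -/
theorem sum_b_add {t u : ℕ} (h1 : T.stageStart t ≤ u) (h2 : u ≤ t) :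
    ∑ v ∈ Finset.Ico (T.stageStart t) u, T.b v + I.scaledCost y (T.s u).C (T.s u).cur =
      I.scaledCost y (T.s (T.stageStart t)).C (T.s (T.stageStart t)).cur +
        ∑ v ∈ Finset.Ico (T.stageStart t) u, T.Δ v := by
  induction u, h1 using Nat.le_induction with
  | base => simp
  | succ u hu ih =>
    have ih := ih (by omega)
    rw [Finset.sum_Ico_succ_top hu, Finset.sum_Ico_succ_top hu, T.b_eq u,
      T.next_of_not_ends (T.not_ends hu h2)]
    unfold Snapshot.continue
    dsimp only
    linarith

/-- The star bound contributes 1 + 2H, with H the harmonic number. The third H comes from the errors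
`φ`: the number of current clients grows by one per time in a stage, so these sum to at most H times
the latest optimum. -/
theorem sum_Δ_le {t u : ℕ} (h1 : T.stageStart t ≤ u) (h2 : u ≤ t) :
    ∑ v ∈ Finset.Ico (T.stageStart t) (u + 1), T.Δ v ≤
      √2 * (1 + 3 * harmonic u) * T.a u := by
  have hH : (0 : ℝ) ≤ harmonic u := by
    rw [← sum_inv_range]
    positivity
  have hs := Real.sqrt_nonneg 2
  set φ : ℕ → ℝ := fun v => optOn y (T.s v).C / (T.s v).C.card with hφ
  have hle : ∀ v ∈ Finset.Ico (T.stageStart t) (u + 1), T.stageStart t ≤ v ∧ v ≤ t := fun v hv => by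
    have := Finset.mem_Ico.1 hv
    omega
  have hφsum : ∑ v ∈ Finset.Ico (T.stageStart t) (u + 1), φ v ≤ harmonic u * T.a u := by
    have h3 : ∀ v ∈ Finset.Ico (T.stageStart t) (u + 1), φ v ≤ T.a u * ((T.s v).C.card : ℝ)⁻¹ := by
      intro v hv
      have hv' := hle v hv
      simp only [hφ, div_eq_mul_inv]
      refine mul_le_mul_of_nonneg_right (optOn_mono y ?_) (by positivity)
      rw [T.C_eq_of_le hv'.1 hv'.2, T.insert_C_eq h1 h2]
      exact Finset.union_subset_union_right
        (Finset.Ico_subset_Ico_right (Finset.mem_Ico.1 hv).2.le)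
    refine (Finset.sum_le_sum h3).trans ?_
    rw [← Finset.mul_sum, mul_comm, ← sum_inv_range]
    refine mul_le_mul_of_nonneg_right ?_ (T.a_nonneg u)
    refine sum_comp_le_sum_range (c := fun v => (T.s v).C.card) (g := fun n : ℕ => (n : ℝ)⁻¹) ?_ ?_
      fun n => by positivity
    · intro v hv w hw hvw
      have hv' := hle v hv
      have hw' := hle w hw
      dsimp only at hvw
      rw [T.card_C_of_le hv'.1 hv'.2, T.card_C_of_le hw'.1 hw'.2] at hvw
      omega
    · intro v hv
      have h4 := Finset.card_le_card (T.valid v).subset_range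
      rw [Finset.card_range] at h4
      exact h4.trans_lt (Finset.mem_Ico.1 hv).2
  have key := le_mul_optOn y (C := insert u (T.s u).C)
    (a := ∑ v ∈ Finset.Ico (T.stageStart t) (u + 1), T.Δ v)
    (b := √2 * ∑ v ∈ Finset.Ico (T.stageStart t) (u + 1), φ v)
    (α := √2 * (1 + 2 * harmonic u)) (by positivity) fun r hr => ?_
  · have h5 := mul_le_mul_of_nonneg_left hφsum hs
    unfold a at *
    linarith
  · rw [T.insert_C_eq h1 h2]
    refine (sum_increase_le (T.C₀_subset_range t)
      (e := fun v j => (y j).dist ((T.s v).cur.σ j)) (φ := φ)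
      (fun v => div_nonneg (optOn_nonneg _ _) (Nat.cast_nonneg _))
      (fun v _ k => (T.step v).connect.increase_le k) ?_ ?_ hr).trans (le_of_eq (by ring))
    · intro v hv k j hj
      have hv' := hle v hv
      rw [← T.C_eq_of_le hv'.1 hv'.2] at hj
      refine ((T.step v).connect.increase_le_of_mem ((T.valid v).cur_feasible j hj)).trans ?_
      have h6 := (y v).dist_le ((T.s v).cur.σ j) k
      have h7 := (y j).le_dist_add_dist k ((T.s v).cur.σ j)
      gcongr
      linarith
    · intro v hv k R hR
      have hv' := hle v hv
      rw [← T.C_eq_of_le hv'.1 hv'.2] at hR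
      exact (T.valid v).open_inequality k R hR

theorem optOn_C₀_le {t u : ℕ} (h1 : T.stageStart t ≤ u) (h2 : u ≤ t) :
    optOn y (T.s t).C₀ ≤ T.a u := by
  unfold a
  rw [T.insert_C_eq h1 h2]
  exact optOn_mono y Finset.subset_union_left

theorem sum_b_le {t u : ℕ} (h1 : T.stageStart t ≤ u) (h2 : u ≤ t) {H : ℝ}
    (hH : (harmonic u : ℝ) ≤ H) :
    ∑ v ∈ Finset.Ico (T.stageStart t) (u + 1), T.b v ≤ √2 * (4 + 3 * H) * T.a u := by
  have e := T.sum_b_add h1 h2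
  have h3 := T.sum_Δ_le h1 h2
  -- The last summand is split off because the stage may end at time `u`, where the next state is
  -- not the settled solution; `b_eq` handles it directly.
  rw [Finset.sum_Ico_succ_top h1] at h3 ⊢
  have h4 := T.b_eq u
  have h5 := I.scaledCost_nonneg y (insert u (T.s u).C) (T.q u)
  have h6 : I.scaledCost y (T.s (T.stageStart t)).C (T.s (T.stageStart t)).cur ≤
      √2 * (3 * T.a u) := by
    refine (I.scaledCost_le y _ _).trans (mul_le_mul_of_nonneg_left ?_ (Real.sqrt_nonneg 2))
    refine (T.valid _).cur_le.trans (mul_le_mul_of_nonneg_left ?_ zero_le_three)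
    rw [T.C_eq_of_le le_rfl (T.stageStart_le t), Finset.Ico_self, Finset.union_empty]
    exact T.optOn_C₀_le h1 h2
  have h7 : √2 * (1 + 3 * harmonic u) * T.a u ≤ √2 * (1 + 3 * H) * T.a u := by
    have := T.a_nonneg u
    have := Real.sqrt_nonneg 2
    gcongr
  linarith

theorem b_le (t : ℕ) {H : ℝ} (hH : (harmonic t : ℝ) ≤ H) :
    T.b t ≤ √2 * (4 + 3 * H) * T.a t := by
  refine le_trans ?_ (T.sum_b_le (T.stageStart_le t) le_rfl hH)
  exact Finset.single_le_sum (f := T.b) (fun v _ => T.b_nonneg v)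
    (Finset.mem_Ico.2 ⟨T.stageStart_le t, Nat.lt_succ_self t⟩)

theorem b_div_a_le (t : ℕ) {H : ℝ} (hH : (harmonic t : ℝ) ≤ H) (hH0 : 0 ≤ H) :
    T.b t / T.a t ≤ √2 * (4 + 3 * H) :=
  div_le_of_le_mul₀ (T.a_nonneg t) (by positivity) (T.b_le t hH)

theorem N_le (t : ℕ) :
    (T.N t : ℝ) ≤ (1 + √2) / ε' * ((insert t (T.s t).C).card * (T.b t / T.a t)) := by
  have hpos := T.pos
  have hcard : (0 : ℝ) < (insert t (T.s t).C).card := by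
    exact_mod_cast Finset.card_pos.2 (Finset.insert_nonempty t (T.s t).C)
  have hs := Real.sqrt_nonneg 2
  -- A zero optimum gives no guaranteed gain per reconnection. But then `b_le` forces the decrease
  -- to vanish, so no operation was performed.
  rcases (T.a_nonneg t).eq_or_lt with ha | ha
  · have hb := T.b_le t le_rfl
    rw [← ha, mul_zero] at hb
    have := (T.run t).eq_zero (sub_nonpos.1 hb)
    rw [this, ← ha]
    simp
  · have h1 := (T.run t).mul_le
    have h2 : ε' * T.a t / ((1 + √2) * (insert t (T.s t).C).card) * T.N t ≤ T.b t := h1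
    rw [div_mul_eq_mul_div, div_le_iff₀ (by positivity)] at h2
    have e : (1 + √2) / ε' * ((insert t (T.s t).C).card * (T.b t / T.a t)) =
      T.b t * ((1 + √2) * (insert t (T.s t).C).card) / (ε' * T.a t) := by field_simp
    rw [e, le_div_iff₀ (by positivity)]
    linarith

/-- The relative decrease of the scaled cost by local search in the current stage. -/
noncomputable def U (t : ℕ) : ℝ := ∑ u ∈ Finset.Ico (T.stageStart t) t, T.b u / T.a u

theorem U_nonneg (t : ℕ) : 0 ≤ T.U t :=
  Finset.sum_nonneg fun u _ => div_nonneg (T.b_nonneg u) (T.a_nonneg u)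

theorem a_le_of_not_ends {t : ℕ} (h : ¬ T.Ends t) :
    T.a t ≤ I.cost y (T.s t).C₀ (T.s t).start / ε' :=
  (optOn_le y (T.run t).feasible (Finset.insert_nonempty _ _)).trans (not_lt.1 h)

/-- Before the arrival that ends the stage, the optimum stays at most the starting cost over ε',
hence within a factor 3/ε' of the optimum for `C₀`. If the starting cost is zero, as in the first
stage, the optima in question all vanish, and so do the quotients by convention. -/
theorem U_le (t : ℕ) {H : ℝ} (hH : ∀ u ≤ t, (harmonic u : ℝ) ≤ H) :
    T.U t ≤ √2 * (4 + 3 * H) * (1 + Real.log (3 / ε')) := by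
  have hpos := T.pos
  have hH0 : 0 ≤ H := by simpa using hH 0 (Nat.zero_le t)
  have hlog : 0 ≤ Real.log (3 / ε') :=
    Real.log_nonneg ((one_le_div hpos).2 (by linarith [T.le]))
  have hrhs : 0 ≤ √2 * (4 + 3 * H) * (1 + Real.log (3 / ε')) := by positivity
  rcases (T.stageStart_le t).eq_or_lt with hm | hm
  · unfold U
    rw [hm, Finset.Ico_self, Finset.sum_empty]
    exact hrhs
  rcases (T.valid t).optOn_pos with hopt | hzero
  · obtain ⟨n, rfl⟩ : ∃ n, t = n + 1 := ⟨t - 1, by omega⟩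
    have hn : T.stageStart (n + 1) ≤ n := by omega
    have h1 := sum_div_le_of_sum_le (a := T.a) (b := T.b) (B := √2 * (4 + 3 * H)) hopt hn
      (fun u hu1 hu2 => T.optOn_C₀_le hu1 (by omega)) (fun u hu1 hu2 => ?_)
      (fun u _ _ => T.b_nonneg u) (fun u hu1 hu2 => T.sum_b_le hu1 (by omega) (hH u (by omega)))
    · refine h1.trans ?_
      have h2 := T.a_le_of_not_ends (T.not_ends hn (Nat.lt_succ_self n))
      rw [(T.stage_const hn (Nat.le_succ n)).2.2] at h2
      have h3 := (T.valid (n + 1)).start_le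
      have h4 : T.a n / optOn y (T.s (n + 1)).C₀ ≤ 3 / ε' := by
        rw [div_le_div_iff₀ hopt hpos]
        rw [le_div_iff₀ hpos] at h2
        linarith
      have h5 : 0 < T.a n / optOn y (T.s (n + 1)).C₀ :=
        div_pos (hopt.trans_le (T.optOn_C₀_le hn (Nat.le_succ n))) hopt
      have := Real.log_le_log h5 h4
      gcongr
    · unfold a
      rw [T.insert_C_eq hu1 (by omega), T.insert_C_eq (by omega : T.stageStart (n + 1) ≤ u + 1)
        (by omega)]
      exact optOn_mono y (Finset.union_subset_union_right
        (Finset.Ico_subset_Ico_right (by omega)))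
  · refine le_trans (le_of_eq ?_) hrhs
    refine Finset.sum_eq_zero fun u hu => ?_
    obtain ⟨hu1, hu2⟩ := Finset.mem_Ico.1 hu
    have h1 := T.a_le_of_not_ends (T.not_ends hu1 hu2)
    rw [(T.stage_const hu1 hu2.le).2.2, hzero, zero_div] at h1
    rw [le_antisymm h1 (T.a_nonneg u), div_zero]

open Classical in
/-- The number of clients that become frozen after the arrival of client `t`. -/
noncomputable def frozenCount (t : ℕ) : ℕ := if T.Ends t then (T.s t).C₀.card else 0

theorem card_C_succ (t : ℕ) :
    (T.s (t + 1)).C.card + T.frozenCount t = (T.s t).C.card + 1 := by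
  rw [← Finset.card_insert_of_notMem (T.valid t).notMem]
  unfold frozenCount
  split_ifs with h
  · rw [T.next_of_ends h]
    exact Finset.card_sdiff_add_card_eq_card
      ((T.valid t).C₀_subset.trans (Finset.subset_insert _ _))
  · rw [T.next_of_not_ends h]
    rfl

theorem card_C_add_sum (t : ℕ) :
    (T.s t).C.card + ∑ u ∈ Finset.range t, T.frozenCount u = t := by
  induction t with
  | zero => rw [T.init.C_eq]; rfl
  | succ t ih =>
    have := T.card_C_succ t
    rw [Finset.sum_range_succ]
    omega

/-- Potential argument. Each frozen client and each arrival in a finished stage is worth the maximal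
relative decrease of a stage; the running stage counts `U` for every current client. When a stage
ends, `C₀` becomes frozen and `stageStart` advances by the number of arrivals in the stage, which
together pay for all its clients. The 2 before the logarithm, against 1 in `U_le`, covers the final
arrival. -/
theorem sum_N_le_aux (t : ℕ) {H : ℝ} (hH : ∀ u ≤ t, (harmonic u : ℝ) ≤ H) :
    ∑ u ∈ Finset.range t, (T.N u : ℝ) ≤ (1 + √2) / ε' *
      (√2 * (4 + 3 * H) * (2 + Real.log (3 / ε')) * (t - (T.s t).C.card + T.stageStart t) +
        (T.s t).C.card * T.U t) := by
  induction t with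
  | zero => simp [T.init.C_eq, stageStart]
  | succ t ih =>
    have hpos := T.pos
    have ih := ih fun u hu => hH u (by omega)
    have hH0 : 0 ≤ H := by simpa using hH 0 (Nat.zero_le _)
    have hN := T.N_le t
    have hU := T.U_le t fun u hu => hH u (by omega)
    have hU0 := T.U_nonneg t
    have hba := T.b_div_a_le t (hH t (by omega)) hH0
    have hba0 : 0 ≤ T.b t / T.a t := div_nonneg (T.b_nonneg t) (T.a_nonneg t)
    have hcard : ((insert t (T.s t).C).card : ℝ) = (T.s t).C.card + 1 := by
      rw [Finset.card_insert_of_notMem (T.valid t).notMem]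
      push_cast
      rfl
    rw [Finset.sum_range_succ]
    rw [hcard] at hN
    refine (add_le_add ih hN).trans ?_
    rw [← mul_add]
    refine mul_le_mul_of_nonneg_left ?_ (by positivity)
    by_cases h : T.Ends t
    · have h1 : T.U (t + 1) = 0 := by
        unfold U
        rw [T.stageStart_of_ends h, Finset.Ico_self, Finset.sum_empty]
      have h2 := T.card_C_succ t
      have h3 : T.frozenCount t = (T.s t).C₀.card := if_pos h
      have h4 := T.card_C_of_le (T.stageStart_le t) le_rfl
      have h5 := T.stageStart_le t
      rw [h1, T.stageStart_of_ends h]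
      have h6 : ((T.s (t + 1)).C.card : ℝ) + T.stageStart t = t + 1 := by
        have : (T.s (t + 1)).C.card + T.stageStart t = t + 1 := by omega
        exact_mod_cast this
      have h7 : ((T.s t).C.card + 1) * (T.U t + T.b t / T.a t) ≤ ((T.s t).C.card + 1) *
          (√2 * (4 + 3 * H) * (2 + Real.log (3 / ε'))) := by
        refine mul_le_mul_of_nonneg_left ?_ (by positivity)
        linarith
      rw [eq_sub_of_add_eq h6]
      push_cast
      nlinarith
    · have h1 : T.U (t + 1) = T.U t + T.b t / T.a t := by
        unfold U
        rw [T.stageStart_of_not_ends h, Finset.sum_Ico_succ_top (T.stageStart_le t)]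
      have h2 : ((T.s (t + 1)).C.card : ℝ) = (T.s t).C.card + 1 := by
        have h2 := T.card_C_succ t
        have h3 : T.frozenCount t = 0 := if_neg h
        rw [h3, add_zero] at h2
        rw [h2]
        push_cast
        rfl
      rw [h1, h2, T.stageStart_of_not_ends h]
      push_cast
      nlinarith

end Trace

end LocalSearch

/-! ### Client and facility recourse along a run -/

namespace LocalSearch

open FLInstance

namespace Trace

variable {F : Type*} [DecidableEq F] [Nonempty F] {I : FLInstance F} {ε' : ℝ} {y : ℕ → Client I}
  (T : Trace ε' y)

theorem sum_N_le (t : ℕ) {H : ℝ} (hH : ∀ u ≤ t, (harmonic u : ℝ) ≤ H) :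
    ∑ u ∈ Finset.range t, (T.N u : ℝ) ≤ (1 + √2) / ε' *
      (√2 * (4 + 3 * H) * (2 + Real.log (3 / ε')) * (2 * t)) := by
  have hpos := T.pos
  have hH0 : 0 ≤ H := by simpa using hH 0 (Nat.zero_le t)
  have hlog : 0 ≤ Real.log (3 / ε') :=
    Real.log_nonneg ((one_le_div hpos).2 (by linarith [T.le]))
  refine (T.sum_N_le_aux t hH).trans (mul_le_mul_of_nonneg_left ?_ (by positivity))
  have hB : 0 ≤ √2 * (4 + 3 * H) := by positivity
  have hU := T.U_le t hH
  have h1 : ((T.s t).C.card : ℝ) * T.U t ≤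
      (T.s t).C.card * (√2 * (4 + 3 * H) * (2 + Real.log (3 / ε'))) := by
    refine mul_le_mul_of_nonneg_left ?_ (by positivity)
    linarith
  have h2 : (T.stageStart t : ℝ) ≤ t := by exact_mod_cast T.stageStart_le t
  have h3 : √2 * (4 + 3 * H) * (2 + Real.log (3 / ε')) * T.stageStart t ≤
      √2 * (4 + 3 * H) * (2 + Real.log (3 / ε')) * t := by gcongr
  linarith

theorem sum_frozenCount_le (t : ℕ) : ∑ u ∈ Finset.range t, T.frozenCount u ≤ t := by
  have := T.card_C_add_sum t
  omega

/-- The clients that are reconnected at the arrival of client `t`. -/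
def changed (t : ℕ) : Finset ℕ :=
  (Finset.range t).filter fun j => (T.s (t + 1)).cur.σ j ≠ (T.s t).cur.σ j

/-- Connections change through local search or when the clients in `C₀` are reset to the snapshot
taken at the beginning of the stage. -/
theorem card_changed_le (t : ℕ) : (T.changed t).card ≤ T.N t + T.frozenCount t := by
  obtain ⟨R, -, hRN, hR⟩ := (T.run t).changed
  have hq : ∀ j ∈ Finset.range t, j ∉ R → (T.q t).σ j = (T.s t).cur.σ j := fun j hj hjR =>
    (hR j hjR).trans (Function.update_of_ne (Finset.mem_range.1 hj).ne _ _)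
  by_cases h : T.Ends t
  · have hsub : T.changed t ⊆ R ∪ (T.s t).C₀ := by
      intro j hj
      obtain ⟨hj, hne⟩ := Finset.mem_filter.1 hj
      by_contra hn
      rw [Finset.mem_union, not_or] at hn
      rw [T.next_of_ends h] at hne
      exact hne ((if_neg hn.2).trans (hq j hj hn.1))
    have h1 : T.frozenCount t = (T.s t).C₀.card := if_pos h
    rw [h1]
    exact (Finset.card_le_card hsub).trans ((Finset.card_union_le _ _).trans
      (Nat.add_le_add_right hRN _))
  · have hsub : T.changed t ⊆ R := by
      intro j hj
      obtain ⟨hj, hne⟩ := Finset.mem_filter.1 hj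
      by_contra hn
      rw [T.next_of_not_ends h] at hne
      exact hne (hq j hj hn)
    exact (Finset.card_le_card hsub).trans (hRN.trans (Nat.le_add_right _ _))

theorem sum_card_changed_le (t : ℕ) :
    ∑ u ∈ Finset.range t, (T.changed u).card ≤ ∑ u ∈ Finset.range t, T.N u + t := by
  have h := Finset.sum_le_sum fun u (_ : u ∈ Finset.range t) => T.card_changed_le u
  rw [Finset.sum_add_distrib] at h
  have := T.sum_frozenCount_le t
  omega

/-- Local search leaves no idle facility, so one that is idle after freezing was serving a client of
`C₀`. -/
theorem card_idle_succ_le (t : ℕ) :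
    (idle I (T.s (t + 1)).C (T.s (t + 1)).cur).card ≤ T.frozenCount t := by
  classical
  have hidle := idle_eq_empty_of_not_efficient (T.step t).settles.2
  by_cases h : T.Ends t
  · have h1 : T.frozenCount t = (T.s t).C₀.card := if_pos h
    rw [h1]
    refine (Finset.card_le_card ?_).trans (Finset.card_image_le (f := (T.q t).σ))
    intro k hk
    rw [T.next_of_ends h] at hk
    obtain ⟨hkS, hpos, hemp⟩ := Finset.mem_filter.1 hk
    by_contra hn
    refine Finset.notMem_empty k (hidle ▸ Finset.mem_filter.2 ⟨hkS, hpos, fun j hj hjk => ?_⟩)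
    by_cases hjC₀ : j ∈ (T.s t).C₀
    · exact hn (hjk ▸ Finset.mem_image_of_mem _ hjC₀)
    · exact hemp j (Finset.mem_sdiff.2 ⟨hj, hjC₀⟩) ((if_neg hjC₀).trans hjk)
  · rw [T.next_of_not_ends h]
    exact (Finset.card_eq_zero.2 hidle).le.trans (Nat.zero_le _)

/-- The facilities opened at the arrival of client `t`, apart from the permanently opened ones. -/
def opened (t : ℕ) : Finset F := (T.s (t + 1)).cur.S \ (T.s t).cur.S

theorem next_cur_S (t : ℕ) : (T.s (t + 1)).cur.S = (T.q t).S := by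
  by_cases h : T.Ends t
  · rw [T.next_of_ends h]; rfl
  · rw [T.next_of_not_ends h]; rfl

theorem card_opened_le (t : ℕ) :
    (T.opened t).card ≤ 1 + (idle I (T.s t).C (T.s t).cur).card + 2 * T.N t := by
  have hconn := (T.step t).connect
  have h1 : T.opened t ⊆ ((T.q t).S \ T.S' t) ∪ {T.i t} := by
    intro k hk
    unfold opened at hk
    rw [T.next_cur_S, Finset.mem_sdiff] at hk
    by_cases hkS' : k ∈ T.S' t
    · rcases Finset.mem_insert.1 (hconn.subset_insert hkS') with rfl | hkS
      · exact Finset.mem_union_right _ (Finset.mem_singleton_self _)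
      · exact absurd hkS hk.2
    · exact Finset.mem_union_left _ (Finset.mem_sdiff.2 ⟨hk.1, hkS'⟩)
  have h2 := (Finset.card_le_card h1).trans (Finset.card_union_le _ _)
  have h3 := Finset.card_le_card (sdiff_subset_idleOrNew (I := I) (T.S' t) (insert t (T.s t).C)
    (T.q t))
  have h4 := (T.run t).card_idleOrNew (T.S' t)
  have h5 : idleOrNew I (T.S' t) (insert t (T.s t).C) (T.arrival t) =
      idle I (insert t (T.s t).C) (T.arrival t) := idleOrNew_self _ (T.arrival t)
  have h6 := Finset.card_le_card (hconn.idle_subset (T.valid t).notMem)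
  rw [h5] at h4
  rw [Finset.card_singleton] at h2
  have h7 : (idle I (insert t (T.s t).C) (T.arrival t)).card ≤
    (idle I (T.s t).C (T.s t).cur).card := h6
  omega

theorem sum_card_idle_le (t : ℕ) :
    ∑ u ∈ Finset.range t, (idle I (T.s u).C (T.s u).cur).card ≤ t := by
  cases t with
  | zero => simp
  | succ t =>
    rw [Finset.sum_range_succ']
    have h1 := Finset.sum_le_sum fun u (_ : u ∈ Finset.range t) => T.card_idle_succ_le u
    have h2 := T.sum_frozenCount_le t
    have h3 : (idle I (T.s 0).C (T.s 0).cur).card = 0 := by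
      unfold idle
      rw [T.init.cur_eq]
      rfl
    omega

theorem sum_card_opened_le (t : ℕ) :
    ∑ u ∈ Finset.range t, (T.opened u).card ≤ 2 * t + 2 * ∑ u ∈ Finset.range t, T.N u := by
  have h := Finset.sum_le_sum fun u (_ : u ∈ Finset.range t) => T.card_opened_le u
  rw [Finset.sum_add_distrib, Finset.sum_add_distrib, ← Finset.mul_sum] at h
  have h2 := T.sum_card_idle_le t
  simp only [Finset.sum_const, Finset.card_range, smul_eq_mul, mul_one] at h
  omega

theorem card_S_add_sum (t : ℕ) :
    (T.s t).cur.S.card + ∑ u ∈ Finset.range t, ((T.s u).cur.S \ (T.s (u + 1)).cur.S).card =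
      ∑ u ∈ Finset.range t, (T.opened u).card := by
  induction t with
  | zero => rw [T.init.cur_eq]; rfl
  | succ t ih =>
    rw [Finset.sum_range_succ, Finset.sum_range_succ, ← ih]
    have h1 := Finset.card_sdiff_add_card (T.s t).cur.S (T.s (t + 1)).cur.S
    have h2 := Finset.card_sdiff_add_card (T.s (t + 1)).cur.S (T.s t).cur.S
    rw [Finset.union_comm] at h2
    unfold opened
    omega

theorem frozen_subset (t : ℕ) : (T.s t).frozen ⊆ (T.s (t + 1)).frozen := by
  by_cases h : T.Ends t
  · rw [T.next_of_ends h]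
    exact Finset.subset_union_left
  · rw [T.next_of_not_ends h]
    exact subset_rfl

/-- `O` collects all facilities ever opened by the current solutions. Permanently opened facilities
come from earlier snapshots and hence lie in `O`. -/
theorem exists_frozen_subset (t : ℕ) :
    ∃ O : Finset F, O.card ≤ ∑ u ∈ Finset.range t, (T.opened u).card ∧
      (T.s t).frozen ⊆ O ∧ (T.s t).start.S ⊆ O ∧ (T.s t).cur.S ⊆ O := by
  induction t with
  | zero =>
    refine ⟨∅, by simp, ?_, ?_, ?_⟩
    · rw [T.init.frozen_eq]
    · rw [T.init.start_eq]
    · rw [T.init.cur_eq]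
  | succ t ih =>
    obtain ⟨O, hO, h1, h2, h3⟩ := ih
    have hO' : O ⊆ O ∪ T.opened t := Finset.subset_union_left
    have hcur : (T.s (t + 1)).cur.S ⊆ O ∪ T.opened t := by
      intro k hk
      by_cases hkS : k ∈ (T.s t).cur.S
      · exact hO' (h3 hkS)
      · exact Finset.mem_union_right _ (Finset.mem_sdiff.2 ⟨hk, hkS⟩)
    refine ⟨O ∪ T.opened t, ?_, ?_, ?_, hcur⟩
    · rw [Finset.sum_range_succ]
      exact (Finset.card_union_le _ _).trans (Nat.add_le_add_right hO _)
    · by_cases h : T.Ends t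
      · rw [T.next_of_ends h]
        exact Finset.union_subset (h1.trans hO') (h2.trans hO')
      · rw [T.next_of_not_ends h]
        exact h1.trans hO'
    · by_cases h : T.Ends t
      · rw [T.next_of_ends h] at hcur ⊢
        exact hcur
      · rw [T.next_of_not_ends h]
        exact h2.trans hO'

theorem sum_card_frozen_sdiff (t : ℕ) :
    ∑ u ∈ Finset.range t, ((T.s (u + 1)).frozen \ (T.s u).frozen).card = (T.s t).frozen.card := by
  induction t with
  | zero => rw [T.init.frozen_eq]; rfl
  | succ t ih =>
    rw [Finset.sum_range_succ, ih]
    have := Finset.card_sdiff_add_card_eq_card (T.frozen_subset t)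
    omega

/-- The open facilities at time `t`. -/
def facilities (t : ℕ) : Finset F := (T.s t).frozen ∪ (T.s t).cur.S

/-- Changes are closings, openings and newly frozen facilities. Each kind totals at most the number
of openings, whence 3 times the bound 2t + 2∑N. -/
theorem sum_card_symmDiff_le (t : ℕ) :
    ∑ u ∈ Finset.range t, (symmDiff (T.facilities u) (T.facilities (u + 1))).card ≤
      6 * t + 6 * ∑ u ∈ Finset.range t, T.N u := by
  have hstep : ∀ u, (symmDiff (T.facilities u) (T.facilities (u + 1))).card ≤
      ((T.s u).cur.S \ (T.s (u + 1)).cur.S).card + (T.opened u).card +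
        ((T.s (u + 1)).frozen \ (T.s u).frozen).card := by
    intro u
    refine (Finset.card_le_card ?_).trans ((Finset.card_union_le _ _).trans
      (Nat.add_le_add_right (Finset.card_union_le _ _) _))
    intro k hk
    have hfr : k ∈ (T.s u).frozen → k ∈ (T.s (u + 1)).frozen := fun h => T.frozen_subset u h
    simp only [facilities, opened, Finset.mem_symmDiff, Finset.mem_union, Finset.mem_sdiff] at hk ⊢
    tauto
  have h := Finset.sum_le_sum fun u (_ : u ∈ Finset.range t) => hstep u
  rw [Finset.sum_add_distrib, Finset.sum_add_distrib, T.sum_card_frozen_sdiff] at h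
  obtain ⟨O, hO, hfr, -, -⟩ := T.exists_frozen_subset t
  have h1 := Finset.card_le_card hfr
  have h2 := T.card_S_add_sum t
  have h3 := T.sum_card_opened_le t
  omega

end Trace

/-! ### The online algorithm and its play against an adversary -/

section Existence

variable {F : Type*} [DecidableEq F] {I : FLInstance F} {ε' : ℝ}

theorem exists_step [Finite F] [Nonempty F] (hε : 0 ≤ ε') {t : ℕ} (x : Fin (t + 1) → Client I)
    (s : State F t) : ∃ s', Step ε' x s s' := by
  obtain ⟨S', i, hconn⟩ := exists_initialConnect (x (Fin.last t)) s.cur.S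
  obtain ⟨q, hq⟩ := exists_settles hε x (insert (Fin.last t) (s.C.map Fin.castSuccEmb))
    ⟨S', Fin.snoc (α := fun _ => F) s.cur.σ i⟩
  exact ⟨_, S', i, q, hconn, hq, rfl⟩

/-- The states of the algorithm, for some choice of efficient operations. -/
noncomputable def state [Finite F] [Nonempty F] (hε : 0 ≤ ε') :
    (t : ℕ) → (Fin t → Client I) → State F t
  | 0, _ => ⟨∅, ⟨∅, Fin.elim0⟩, ∅, ⟨∅, Fin.elim0⟩, ∅⟩
  | t + 1, x => (exists_step hε x (state hε t fun j => x j.castSucc)).choose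

theorem state_step [Finite F] [Nonempty F] (hε : 0 ≤ ε') (t : ℕ) (x : Fin (t + 1) → Client I) :
    Step ε' x (state hε t fun j => x j.castSucc) (state hε (t + 1) x) :=
  (exists_step hε x (state hε t fun j => x j.castSucc)).choose_spec

theorem exists_trace [Finite F] [Nonempty F] (hε : 0 < ε') (hε1 : ε' ≤ 1 / 100) (d : F)
    (y : ℕ → Client I) :
    ∃ T : Trace ε' y, ∀ t, T.s t = (state hε.le t fun j => y j).snapshot d := by
  choose S' i q h using fun t => (state_step hε.le t fun j => y j).exists_transition d
  exact ⟨⟨_, S', i, q, ⟨rfl, rfl, rfl, rfl, rfl⟩, h, hε, hε1⟩, fun t => rfl⟩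

/-- A client at the location of a facility. -/
def _root_.FLInstance.clientAt (I : FLInstance F) (k : F) : Client I where
  dist i := I.dist k i
  dist_nonneg i := I.dist_nonneg k i
  dist_le i i' := I.dist_triangle k i' i
  le_dist_add_dist i i' := by
    rw [I.dist_comm k i]
    exact I.dist_triangle i k i'

/-- The finite history is padded to an infinite sequence with arbitrary clients, so that the
invariant of runs applies. -/
theorem state_σ_mem [Finite F] [Nonempty F] (hε : 0 < ε') (hε1 : ε' ≤ 1 / 100) {t : ℕ}
    (x : Fin t → Client I) (j : Fin t) :
    (state hε.le t x).cur.σ j ∈ (state hε.le t x).frozen ∪ (state hε.le t x).cur.S := by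
  have d : F := Classical.arbitrary F
  obtain ⟨T, hT⟩ := exists_trace hε hε1 d
    fun j => if h : j < t then x ⟨j, h⟩ else I.clientAt d
  have hx : (fun j : Fin t => if h : (j : ℕ) < t then x ⟨j, h⟩ else I.clientAt d) = x := by
    funext j
    simp
  have hv := T.valid t
  have hTt := hT t
  rw [hx] at hTt
  rw [hTt] at hv
  have hσ : ((state hε.le t x).snapshot d).cur.σ j = (state hε.le t x).cur.σ j := extend_val d _ j
  rw [← hσ]
  by_cases hj : (j : ℕ) ∈ ((state hε.le t x).snapshot d).C
  · exact Finset.mem_union_right _ (hv.cur_feasible j hj)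
  · exact Finset.mem_union_left _ (hv.mem_frozen j
      (Finset.mem_sdiff.2 ⟨Finset.mem_range.2 j.isLt, hj⟩))

/-- Local search in stages with freezing, as an online algorithm. -/
noncomputable def algorithm [Finite F] [Nonempty F] (hε : 0 < ε') (hε1 : ε' ≤ 1 / 100) :
    OnlineAlgorithm I := fun t x =>
  { S := (state hε.le t x).frozen ∪ (state hε.le t x).cur.S
    σ := (state hε.le t x).cur.σ
    σ_mem := state_σ_mem hε hε1 x }

theorem algorithm_isStagedLocalSearch [Finite F] [Nonempty F] (hε : 0 < ε')
    (hε1 : ε' ≤ 1 / 100) :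
    (algorithm hε hε1 : OnlineAlgorithm I).IsStagedLocalSearch ε' :=
  ⟨state hε.le, fun _ => ⟨rfl, rfl, rfl⟩, state_step hε.le, fun _ _ => ⟨rfl, rfl⟩⟩

variable [Finite F] [Nonempty F] (hε : 0 < ε') (hε1 : ε' ≤ 1 / 100) (adv : Adversary I)

theorem map_univ_val (t : ℕ) :
    (Finset.univ : Finset (Fin t)).map Fin.valEmbedding = Finset.range t := by
  ext j
  simp

theorem optOn_range_le_opt (y : ℕ → Client I) {t : ℕ} (ht : 0 < t) :
    optOn y (Finset.range t) ≤ I.opt fun j : Fin t => y j := by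
  have d : F := Classical.arbitrary F
  have : Nonempty (Solution F t) := ⟨⟨⟨{d}, fun _ => d⟩, fun _ => Finset.mem_singleton_self d⟩⟩
  refine le_ciInf fun r => ?_
  rw [← cost_extend y d, map_univ_val]
  refine optOn_le y (fun j hj => ?_) ⟨0, Finset.mem_range.2 ht⟩
  have := extend_val d r.σ ⟨j, Finset.mem_range.1 hj⟩
  unfold extendConfig
  dsimp only at this ⊢
  rw [this]
  exact r.σ_mem _

theorem algorithm_cost_le (t : ℕ) :
    I.cost ((algorithm hε hε1).history adv t) Finset.univ
        ((algorithm hε hε1).solution adv t).toConfig ≤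
      (1 + √2 + 17 * ε') * I.opt ((algorithm hε hε1).history adv t) := by
  have d : F := Classical.arbitrary F
  set y := (algorithm hε hε1).arrivals adv
  obtain ⟨T, hT⟩ := exists_trace hε hε1 d y
  have hcoef : 0 ≤ 1 + √2 + 17 * ε' := by positivity
  rcases Nat.eq_zero_or_pos t with rfl | ht
  · refine le_trans (le_of_eq ?_) (mul_nonneg hcoef (Real.iInf_nonneg fun r => I.cost_nonneg _ _ _))
    change I.facCost (∅ ∪ ∅) + I.connCost _ _ _ = 0
    simp [facCost, connCost]
  · refine le_trans (le_of_eq ?_) ((T.valid t).cost_le.trans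
      (mul_le_mul_of_nonneg_left (optOn_range_le_opt y ht) hcoef))
    rw [hT t]
    refine congrArg (I.facCost _ + ·) ?_
    rw [← map_univ_val]
    exact (connCost_extend y d _ _).symm

theorem algorithm_recourse_le (t : ℕ) {H : ℝ} (hH : ∀ u ≤ t, (harmonic u : ℝ) ≤ H) :
    ((algorithm hε hε1).facilityRecourse adv t : ℝ) ≤ 6 * t + 6 * ((1 + √2) / ε' *
        (√2 * (4 + 3 * H) * (2 + Real.log (3 / ε')) * (2 * t))) ∧
      ((algorithm hε hε1).clientRecourse adv t : ℝ) ≤ t + (1 + √2) / ε' *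
        (√2 * (4 + 3 * H) * (2 + Real.log (3 / ε')) * (2 * t)) := by
  have d : F := Classical.arbitrary F
  set y := (algorithm hε hε1).arrivals adv
  obtain ⟨T, hT⟩ := exists_trace hε hε1 d y
  have hN := T.sum_N_le t hH
  constructor
  · have h1 : (algorithm hε hε1).facilityRecourse adv t ≤
        6 * t + 6 * ∑ u ∈ Finset.range t, T.N u := by
      refine le_trans (le_of_eq (Finset.sum_congr rfl fun u _ => ?_)) (T.sum_card_symmDiff_le t)
      unfold Trace.facilities
      rw [hT u, hT (u + 1)]
      rfl
    have h2 : ((algorithm hε hε1).facilityRecourse adv t : ℝ) ≤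
        6 * t + 6 * ∑ u ∈ Finset.range t, (T.N u : ℝ) := by exact_mod_cast h1
    linarith
  · have h1 : (algorithm hε hε1).clientRecourse adv t ≤ ∑ u ∈ Finset.range t, T.N u + t := by
      refine (Finset.sum_le_sum fun u _ => ?_).trans (T.sum_card_changed_le t)
      refine Finset.card_le_card_of_injOn (fun j => (j : ℕ)) (fun j hj => ?_)
        fun j _ k _ hjk => Fin.ext hjk
      refine Finset.mem_coe.2 (Finset.mem_filter.2 ⟨Finset.mem_range.2 j.isLt, ?_⟩)
      have hj' := (Finset.mem_filter.1 (Finset.mem_coe.1 hj)).2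
      rw [hT u, hT (u + 1)]
      intro heq
      refine hj' ?_
      exact (extend_val d (state hε.le (u + 1) fun j => y j).cur.σ j.castSucc).symm.trans
        (heq.trans (extend_val d (state hε.le u fun j => y j).cur.σ j))
    have h2 : ((algorithm hε hε1).clientRecourse adv t : ℝ) ≤
        ∑ u ∈ Finset.range t, (T.N u : ℝ) + t := by exact_mod_cast h1
    linarith

end Existence

/-- The recourse bounds in the form of a constant times `log n / ε * log (1 / ε)`. -/
theorem recourse_bound_le {ε n T : ℝ} (hε : 0 < ε) (hε1 : ε ≤ 1 / 2) (hn : 2 ≤ n) (hT : 0 ≤ T) :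
    6 * T + 6 * ((1 + √2) / (1 / 100 * ε) *
        (√2 * (4 + 3 * (1 + Real.log n)) * (2 + Real.log (3 / (1 / 100 * ε))) * (2 * T))) ≤
      800000 * (Real.log n / ε * Real.log (1 / ε)) * T := by
  have h2 : (69 / 100 : ℝ) ≤ Real.log 2 := by linarith [Real.log_two_gt_d9]
  have hl : 69 / 100 ≤ Real.log n := h2.trans (Real.log_le_log (by norm_num) hn)
  have he : 69 / 100 ≤ Real.log (1 / ε) :=
    h2.trans (Real.log_le_log (by norm_num) (by rw [le_div_iff₀ hε]; linarith))
  have h300 : Real.log 300 ≤ 6 := by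
    rw [Real.log_le_iff_le_exp (by norm_num)]
    have h1 : (2.7 : ℝ) ≤ Real.exp 1 := by linarith [Real.exp_one_gt_d9]
    have h3 : Real.exp 6 = Real.exp 1 ^ 6 := by rw [← Real.exp_nat_mul]; norm_num
    rw [h3]
    exact le_trans (by norm_num) (pow_le_pow_left₀ (by norm_num) h1 6)
  have hlog : Real.log (3 / (1 / 100 * ε)) = Real.log 300 + Real.log (1 / ε) := by
    rw [← Real.log_mul (by norm_num) (by positivity)]
    congr 1
    field_simp
    norm_num
  set l := Real.log n
  set e := Real.log (1 / ε)
  have hs0 := Real.sqrt_nonneg 2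
  have hs1 : √2 ≤ 71 / 50 := by linarith [one_add_sqrt_two_le]
  -- Additive constants are absorbed since both logarithms are at least log 2 > 69/100.
  have hA : 4 + 3 * (1 + l) ≤ 14 * l := by linarith
  have hB : 2 + Real.log (3 / (1 / 100 * ε)) ≤ 13 * e := by rw [hlog]; linarith
  have hB0 : 0 ≤ 2 + Real.log (3 / (1 / 100 * ε)) := by
    rw [hlog]
    have : 0 ≤ Real.log 300 := Real.log_nonneg (by norm_num)
    linarith
  have h1 : √2 * (4 + 3 * (1 + l)) * (2 + Real.log (3 / (1 / 100 * ε))) * (2 * T) ≤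
      71 / 50 * (14 * l) * (13 * e) * (2 * T) := by
    gcongr
  have h3 : (1 + √2) / (1 / 100 * ε) ≤ (121 / 50) / (1 / 100 * ε) := by
    gcongr
    exact one_add_sqrt_two_le
  have h4 := mul_le_mul h3 h1 (by positivity) (by positivity)
  have h5 : T ≤ 2 * (l / ε * e) * T := by
    refine le_mul_of_one_le_left hT ?_
    rw [div_mul_eq_mul_div, ← mul_div_assoc, le_div_iff₀ hε]
    nlinarith
  have h6 : (121 / 50) / (1 / 100 * ε) * (71 / 50 * (14 * l) * (13 * e) * (2 * T)) =
      (242 * (71 / 50) * 14 * 13 * 2) * (l / ε * e * T) := by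
    field_simp
    ring
  have h7 : 0 ≤ l / ε * e * T := by positivity
  rw [h6] at h4
  linarith

end LocalSearch

theorem theorem1 :
    ∃ c K : ℝ, 0 < c ∧ 0 < K ∧
      ∀ ε : ℝ, 0 < ε → ε ≤ 1 / 2 →
      ∀ (F : Type*) [Fintype F] [Nonempty F] [DecidableEq F] (I : FLInstance F),
      ∃ A : OnlineAlgorithm I, A.IsStagedLocalSearch (c * ε) ∧
        ∀ (adv : Adversary I) (T : ℕ),
          I.cost (A.history adv T) Finset.univ (A.solution adv T).toConfig
              ≤ (1 + √2 + ε) * I.opt (A.history adv T) ∧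
          (A.facilityRecourse adv T : ℝ)
              ≤ K * (Real.log ((Fintype.card F : ℝ) + T) / ε * Real.log (1 / ε)) * T ∧
          (A.clientRecourse adv T : ℝ)
              ≤ K * (Real.log ((Fintype.card F : ℝ) + T) / ε * Real.log (1 / ε)) * T := by
  -- With c = 1/100, the error 17ε' is below ε and ε' ≤ 1/100 as the invariants require.
  refine ⟨1 / 100, 800000, by norm_num, by norm_num, fun ε hε hε1 F _ _ _ I => ?_⟩
  have hc : 0 < 1 / 100 * ε := by positivity
  have hc1 : 1 / 100 * ε ≤ 1 / 100 := by linarith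
  refine ⟨LocalSearch.algorithm hc hc1, LocalSearch.algorithm_isStagedLocalSearch hc hc1,
    fun adv T => ⟨?_, ?_⟩⟩
  · refine (LocalSearch.algorithm_cost_le hc hc1 adv T).trans
      (mul_le_mul_of_nonneg_right (by linarith) (Real.iInf_nonneg fun r => I.cost_nonneg _ _ _))
  -- For T ≥ 1 one has n ≥ 2, which keeps log n away from zero; at T = 0 it may vanish, but there is
  -- no recourse.
  · rcases Nat.eq_zero_or_pos T with rfl | hT
    · simp [OnlineAlgorithm.facilityRecourse, OnlineAlgorithm.clientRecourse]
    have hF : (1 : ℝ) ≤ Fintype.card F := by exact_mod_cast Fintype.card_pos (α := F)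
    have hT' : (1 : ℝ) ≤ T := by exact_mod_cast hT
    have hH : ∀ u ≤ T, (harmonic u : ℝ) ≤ 1 + Real.log ((Fintype.card F : ℝ) + T) := by
      intro u hu
      rcases Nat.eq_zero_or_pos u with rfl | hu0
      · have := Real.log_nonneg (by linarith : (1 : ℝ) ≤ (Fintype.card F : ℝ) + T)
        rw [harmonic_zero, Rat.cast_zero]
        linarith
      · refine (harmonic_le_one_add_log u).trans (add_le_add_right (Real.log_le_log ?_ ?_) 1)
        · exact_mod_cast hu0
        · have : (u : ℝ) ≤ T := by exact_mod_cast hu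
          linarith
    obtain ⟨h1, h2⟩ := LocalSearch.algorithm_recourse_le hc hc1 adv T hH
    have h3 := LocalSearch.recourse_bound_le hε hε1
      (by linarith : (2 : ℝ) ≤ (Fintype.card F : ℝ) + T) (by linarith : (0 : ℝ) ≤ T)
    refine ⟨h1.trans h3, ?_⟩
    linarith
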